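/- Let $\gamma\in[-1,1]$. For each $N$ let $G_N=(G_{ij})_{i,j=1}^N$ be a real Gaussian elliptic matrix of parameter $\gamma$: the random elements $G_{ii}$ $(1\le i\le N)$ and $(G_{ij},G_{ji})$ $(1\le i<j\le N)$ are independent; the pairs $(G_{ij},G_{ji})$, $i<j$, are i.i.d. centered real Gaussian vectors with $\mathbb E G_{ij}^2=\mathbb E G_{ji}^2=1$ and $\mathbb E G_{ij}G_{ji}=\gamma$; and the $G_{ii}$ are i.i.d. centered real Gaussian variables with $\mathbb E G_{ii}^2=1+\gamma$. Let $X=X_N=N^{-1/2}G_N$, $X^1=X$ and $X^*=X^T$. Let $p,q\ge 1$, let $\tau:[p+q]\to\{1,*\}$, and put $$W_1=\operatorname{Tr}\big(X^{\tau(1)}\cdots X^{\tau(p)}\big),\qquad W_2=\operatorname{Tr}\big(X^{\tau(p+1)}\cdots X^{\tau(p+q)}\big).$$ Let $NC_2(p,q)$ be the set of non-crossing annular pair partitions: place $1,\dots,p$ clockwise on the inner circle and $p+1,\dots,p+q$ counterclockwise on the outer circle of an annulus; a pair partition $\pi$ of $[p+q]$ belongs to $NC_2(p,q)$ if at least one pair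 joins the two circles and the pairs can be drawn in the annulus as curves that do not cross. A pair that joins the two circles is called a spoke. For a word $\sigma:[p+q]\to\{1,*\}$ let $s(\pi;\sigma)$ be the number of pairs $\{x,y\}\in\pi$ with $\sigma(x)=\sigma(y)$, let $a(\pi)$ be the number of spokes of $\pi$, and let $s_{\mathrm{sp}}(\pi;\sigma)$ be the number of spokes $\{x,y\}\in\pi$ with $\sigma(x)=\sigma(y)$. Let $\hat\tau$ be the word $\tau$ with the outer circle read in reversed order, that is, $\hat\tau(i)=\tau(i)$ for $1\le i\le p$ and $\hat\tau(p+j)=\tau(p+q+1-j)$ for $1\le j\le q$. Then $W_1$ and $W_2$ have finite second moments for every $N$, and $$\lim_{N\to\infty}\operatorname{Cov}(W_1,W_2)=\sum_{\pi\in NC_2(p,q)}\Big(\gamma^{\,s(\pi;\tau)}+\gamma^{\,s(\pi;\hat\tau)+a(\pi)-2s_{\mathrm{sp}}(\pi;\hat\tau)}\Big),$$ where $\gamma^0=1$ also for $\gamma=0$. -/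

import Mathlib

open MeasureTheory ProbabilityTheory Filter Topology
open scoped Matrix

namespace EllipticCov

/-! ### The real Gaussian elliptic matrix -/

/-- `G` is, under `P`, a (non-normalized) real Gaussian elliptic `N × N` matrix of parameter `γ`.
For `i = j` the pair `(G i i, G i i)` generates the same σ-algebra as `G i i`, so `indep` is the
joint independence of all diagonal entries and all the pairs `(G i j, G j i)`, `i < j`.
A Gaussian law on `ℝ × ℝ` or `ℝ` is determined by its means and second moments (which are the same
for all `i < j`, resp. for all `i`), so that identical distribution is included. -/
structure IsRealGaussianElliptic {Ω : Type*} [MeasurableSpace Ω] {N : ℕ} (γ : ℝ)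
    (G : Ω → Matrix (Fin N) (Fin N) ℝ) (P : Measure Ω) : Prop where
  indep : iIndepFun
    (fun (e : {e : Fin N × Fin N // e.1 ≤ e.2}) (ω : Ω) =>
      (G ω e.1.1 e.1.2, G ω e.1.2 e.1.1)) P
  gaussian_offDiag : ∀ i j, i < j → HasGaussianLaw (fun ω => (G ω i j, G ω j i)) P
  gaussian_diag : ∀ i, HasGaussianLaw (fun ω => G ω i i) P
  centered : ∀ i j, ∫ ω, G ω i j ∂P = 0
  sq_offDiag : ∀ i j, i ≠ j → ∫ ω, (G ω i j) ^ 2 ∂P = 1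
  mul_offDiag : ∀ i j, i ≠ j → ∫ ω, G ω i j * G ω j i ∂P = γ
  sq_diag : ∀ i, ∫ ω, (G ω i i) ^ 2 ∂P = 1 + γ

/-- The normalized matrix `X = N ^ (-1/2) G`. -/
noncomputable def normalized {N : ℕ} (G : Matrix (Fin N) (Fin N) ℝ) :
    Matrix (Fin N) (Fin N) ℝ :=
  (1 / √(N : ℝ)) • G

/-- The type alphabet `{1, ∗}`. -/
inductive Letter
  | one
  | star
  deriving DecidableEq

/-- `A ^ 1 = A` and `A ^ ∗ = Aᵀ` (real matrices). -/
def Letter.apply {N : ℕ} : Letter → Matrix (Fin N) (Fin N) ℝ → Matrix (Fin N) (Fin N) ℝ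
  | .one, A => A
  | .star, A => Aᵀ

/-- `Tr (A ^ w(1) A ^ w(2) ⋯ A ^ w(n))`. -/
def traceWord {n N : ℕ} (w : Fin n → Letter) (A : Matrix (Fin N) (Fin N) ℝ) : ℝ :=
  ((List.ofFn fun t => (w t).apply A).prod).trace

/-! ### Non-crossing annular pair partitions

The `p` points of the inner circle, numbered clockwise, are `Sum.inl i`, and the `q` points of the
outer circle, numbered counterclockwise, are `Sum.inr j`. -/

/-- A pair partition, identified with the fixed-point-free involution that swaps the two points of
each pair. -/
def IsPairPartition {V : Type*} (π : Equiv.Perm V) : Prop :=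
  ∀ x, π (π x) = x ∧ π x ≠ x

/-- The linear order of the boundary points when the annulus is cut open along a curve from the
inner point `u` to the outer point `v`: the result is a disc, and going around its boundary one
meets `u, u + 1, …, u - 1` (cyclically on the inner circle, at the positions `0, …, p - 1`) and then
`v, v + 1, …, v - 1` (cyclically on the outer circle, at the positions `p, …, p + q - 1`). -/
def cutPos {p q : ℕ} (u : Fin p) (v : Fin q) : Fin p ⊕ Fin q → ℕ
  | .inl i => (i.val + (p - u.val)) % p
  | .inr j => p + (j.val + (q - v.val)) % q

/-- In the disc obtained by cutting along the spoke `{u, v}`, the pairs of `π` other than this spoke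
form a non-crossing pair partition: there are no `a < b < c < d` on the boundary with `{a, c}` and
`{b, d}` two of these pairs. -/
def NonCrossingOffSpoke {p q : ℕ} (π : Equiv.Perm (Fin p ⊕ Fin q)) (u : Fin p) (v : Fin q) : Prop :=
  ∀ a b : Fin p ⊕ Fin q,
    a ≠ .inl u → a ≠ .inr v → b ≠ .inl u → b ≠ .inr v →
      ¬ (cutPos u v a < cutPos u v b ∧ cutPos u v b < cutPos u v (π a) ∧
          cutPos u v (π a) < cutPos u v (π b))

/-- `π` is a non-crossing annular pair partition: some pair connects the two circles, and the pairs
can be drawn in the annulus without crossings. Once one spoke `{u, v}` is drawn, all the other pairs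
have to be drawn in the disc that remains when the annulus is cut along it. -/
def IsAnnularNonCrossing {p q : ℕ} (π : Equiv.Perm (Fin p ⊕ Fin q)) : Prop :=
  IsPairPartition π ∧ ∃ (u : Fin p) (v : Fin q), π (.inl u) = .inr v ∧ NonCrossingOffSpoke π u v

instance {p q : ℕ} (π : Equiv.Perm (Fin p ⊕ Fin q)) : Decidable (IsAnnularNonCrossing π) := by
  unfold IsAnnularNonCrossing IsPairPartition NonCrossingOffSpoke
  infer_instance

/-- The set `NC₂(p, q)` of non-crossing annular pair partitions. -/
def NC2 (p q : ℕ) : Finset (Equiv.Perm (Fin p ⊕ Fin q)) :=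
  Finset.univ.filter fun π => IsAnnularNonCrossing π

section Statistics

variable {p q : ℕ}

/-- The set of pairs `{x, π x}`. -/
def pairs (π : Equiv.Perm (Fin p ⊕ Fin q)) : Finset (Finset (Fin p ⊕ Fin q)) :=
  Finset.univ.image fun x => {x, π x}

/-- The pair `B` is of the same type: its two points carry the same letter. -/
def SameType (τ : Fin p ⊕ Fin q → Letter) (B : Finset (Fin p ⊕ Fin q)) : Prop :=
  ∀ x ∈ B, ∀ y ∈ B, τ x = τ y

/-- The pair `B` is a spoke: it joins an inner point to an outer point. -/
def IsSpoke (B : Finset (Fin p ⊕ Fin q)) : Prop :=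
  (∃ i : Fin p, Sum.inl i ∈ B) ∧ ∃ j : Fin q, Sum.inr j ∈ B

instance (τ : Fin p ⊕ Fin q → Letter) (B : Finset (Fin p ⊕ Fin q)) : Decidable (SameType τ B) := by
  unfold SameType
  infer_instance

instance (B : Finset (Fin p ⊕ Fin q)) : Decidable (IsSpoke B) := by
  unfold IsSpoke
  infer_instance

/-- `s(π; τ)`, the number of same-type pairs. -/
def numSame (π : Equiv.Perm (Fin p ⊕ Fin q)) (τ : Fin p ⊕ Fin q → Letter) : ℕ :=
  ((pairs π).filter fun B => SameType τ B).card

/-- `a(π)`, the number of spokes. -/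
def numSpokes (π : Equiv.Perm (Fin p ⊕ Fin q)) : ℕ :=
  ((pairs π).filter fun B => IsSpoke B).card

/-- `s_sp(π; τ)`, the number of same-type spokes. -/
def numSameSpokes (π : Equiv.Perm (Fin p ⊕ Fin q)) (τ : Fin p ⊕ Fin q → Letter) : ℕ :=
  ((pairs π).filter fun B => IsSpoke B ∧ SameType τ B).card

/-- The exponent `s(π; τ) + a(π) - 2 s_sp(π; τ)` is not affected by truncated subtraction. -/
theorem two_mul_numSameSpokes_le (π : Equiv.Perm (Fin p ⊕ Fin q)) (τ : Fin p ⊕ Fin q → Letter) :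
    2 * numSameSpokes π τ ≤ numSame π τ + numSpokes π := by
  have h1 : numSameSpokes π τ ≤ numSame π τ :=
    Finset.card_le_card (Finset.monotone_filter_right _ fun _ _ h => h.2)
  have h2 : numSameSpokes π τ ≤ numSpokes π :=
    Finset.card_le_card (Finset.monotone_filter_right _ fun _ _ h => h.1)
  omega

/-- The type word in which the outer circle is read in reversed order. -/
def reverseOuter (τ : Fin p ⊕ Fin q → Letter) : Fin p ⊕ Fin q → Letter
  | .inl i => τ (.inl i)
  | .inr j => τ (.inr j.rev)

end Statistics

end EllipticCov

/-! Gaussian integration by parts turns a joint moment of entries into a sum over pair partitions of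
the letters (`integral_mul_prod_of_gaussian`, `eq_sum_pairPerms`). The product of the two
expectations is the same sum restricted to partitions without spokes, so the covariance is the sum
over partitions with a spoke (`sum_pairPerms_sub`).

The covariance of two entries is a sum of two Kronecker terms. One glues the two letters in the same
direction (a twisted pair) with weight 1 for equal letters and γ otherwise; the other glues them in
opposite directions (untwisted) with these weights exchanged. After a choice of twists the sum over
the indices counts colourings of the vertices of the surface glued from a `p`-gon and a `q`-gon.
Each choice thus contributes its weight times `N ^ (v - (p + q) / 2)`, with `v` the number of
vertices (`covariance_traceWord`).

A spoke makes the surface connected, with `(p + q) / 2` edges and two faces. Hence `v ≤ (p + q) /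
2`, and in the limit only spheres survive (`two_mul_numVertices_eq_iff`). This is proved without
topology: cutting along an untwisted spoke leaves one closed word of length `p + q - 2`, whose glued
boundary is a connected graph. Its number of vertices is at most the number of edges plus one, with
equality only for a tree, that is, for untwisted non-crossing gluings (`Walk.reducible`, with
converse `Reducible.exists_walk`). If the spoke is twisted, reflecting the outer circle untwists it:
the reflection changes the twist of the spokes and of no other pair.

So exactly two kinds of gluing survive: nothing twisted and `π` annular non-crossing, or exactly the
spokes twisted and the reflected partition annular non-crossing. Their weights are the two powers of
γ (`sum_gluingWeight`). -/

namespace EllipticCov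

/-! ### Words on a disc -/

section Disc

variable {V K : Type*}

/-- The letters of `L`, the letter `x` leading from `s x` to `e x`, form a walk from `k` to `k'`. -/
def Walk (s e : V → K) : K → List V → K → Prop
  | k, [], k' => k = k'
  | k, x :: L, k' => s x = k ∧ Walk s e (e x) L k'

theorem walk_append {s e : V → K} {k k' : K} {A B : List V} :
    Walk s e k (A ++ B) k' ↔ ∃ m, Walk s e k A m ∧ Walk s e m B k' := by
  induction A generalizing k with
  | nil => simp [Walk]
  | cons x A ih => simp [Walk, ih, and_assoc]

theorem Walk.start_mem {s e : V → K} {k k' : K} {L : List V} (h : Walk s e k L k') :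
    k = k' ∨ ∃ y ∈ L, s y = k := by
  cases L with
  | nil => exact Or.inl h
  | cons x L => exact Or.inr ⟨x, by simp, h.1⟩

theorem Walk.end_mem {s e : V → K} {k k' : K} {L : List V} (h : Walk s e k L k') {z : V}
    (hz : z ∈ L) : e z = k' ∨ ∃ y ∈ L, s y = e z := by
  induction L generalizing k with
  | nil => simp at hz
  | cons x L ih =>
    rcases List.mem_cons.1 hz with rfl | hz
    · rcases h.2.start_mem with h' | ⟨y, hy, h'⟩
      · exact Or.inl h'
      · exact Or.inr ⟨y, by simp [hy], h'⟩
    · rcases ih h.2 hz with h' | ⟨y, hy, h'⟩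
      · exact Or.inl h'
      · exact Or.inr ⟨y, by simp [hy], h'⟩

theorem Walk.congr {s e s' e' : V → K} {k k' : K} {L : List V} (h : Walk s e k L k')
    (hs : ∀ x ∈ L, s' x = s x) (he : ∀ x ∈ L, e' x = e x) : Walk s' e' k L k' := by
  induction L generalizing k with
  | nil => exact h
  | cons x L ih =>
    refine ⟨(hs x (by simp)).trans h.1, ?_⟩
    rw [he x (by simp)]
    exact ih h.2 (fun y hy => hs y (by simp [hy])) (fun y hy => he y (by simp [hy]))

/-- `π` restricts to a pair partition of the set of letters of `L`. -/
def PairsWord (π : Equiv.Perm V) (L : List V) : Prop :=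
  ∀ x ∈ L, π x ∈ L ∧ π x ≠ x ∧ π (π x) = x

theorem PairsWord.remove {π : Equiv.Perm V} {A B : List V} {a b : V}
    (h : PairsWord π (A ++ a :: b :: B)) (hn : (A ++ a :: b :: B).Nodup) (hab : π a = b) :
    PairsWord π (A ++ B) := by
  intro x hx
  have hba : π b = a := by rw [← hab]; exact (h a (by simp)).2.2
  have hxL : x ∈ A ++ a :: b :: B := by
    rcases List.mem_append.1 hx with hx | hx <;> simp [hx]
  obtain ⟨h1, h2, h3⟩ := h x hxL
  refine ⟨?_, h2, h3⟩
  have hxa : x ≠ a := by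
    rintro rfl
    simp only [List.nodup_append, List.nodup_cons, List.mem_cons] at hn
    rcases List.mem_append.1 hx with hx | hx
    · exact hn.2.2 x hx x (Or.inl rfl) rfl
    · exact hn.2.1.1 (Or.inr hx)
  have hxb : x ≠ b := by
    rintro rfl
    simp only [List.nodup_append, List.nodup_cons, List.mem_cons] at hn
    rcases List.mem_append.1 hx with hx | hx
    · exact hn.2.2 x hx x (Or.inr (Or.inl rfl)) rfl
    · exact hn.2.1.2.1 hx
  have ha : π x ≠ a := fun h' => hxb (π.injective (h'.trans hba.symm))
  have hb : π x ≠ b := fun h' => hxa (π.injective (h'.trans hab.symm))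
  simpa [ha, hb] using h1

/-- The letters `x` and `π x` are glued: with the same direction if the pair is twisted, and with
opposite directions otherwise. -/
def Glued (s e : V → K) (π : Equiv.Perm V) (tw : V → Prop) (x : V) : Prop :=
  (tw x → s x = s (π x) ∧ e x = e (π x)) ∧ (¬ tw x → s x = e (π x) ∧ e x = s (π x))

/-- Words that reduce to the empty one by removal of adjacent pairs. -/
inductive Reducible (π : Equiv.Perm V) : List V → Prop
  | nil : Reducible π []
  | insertPair (A B : List V) (a b : V) (hab : π a = b) (h : Reducible π (A ++ B)) :
      Reducible π (A ++ a :: b :: B)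

variable [DecidableEq K]

/-- The set of vertices visited by a closed walk based at `k`. -/
def vertexSet (s : V → K) (k : K) (L : List V) : Finset K := insert k (L.map s).toFinset

/-- Pigeonhole: if every value other than `k` were taken twice, the word would have at least twice
as many letters as such values. -/
theorem exists_simple_value (s : V → K) (k : K) (T : List V)
    (h : T.length < 2 * ((T.map s).toFinset.erase k).card) :
    ∃ A b B, T = A ++ b :: B ∧ s b ≠ k ∧ (∀ z ∈ A, s z ≠ s b) ∧ ∀ z ∈ B, s z ≠ s b := by
  have h1 : ∃ κ ∈ (T.map s).toFinset.erase k, (T.map s).count κ < 2 := by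
    by_contra! hc
    have h2 : 2 * ((T.map s).toFinset.erase k).card ≤
        ∑ κ ∈ (T.map s).toFinset.erase k, (T.map s).count κ := by
      rw [mul_comm, ← smul_eq_mul, ← Finset.sum_const]
      exact Finset.sum_le_sum hc
    have h3 : ∑ κ ∈ (T.map s).toFinset.erase k, (T.map s).count κ ≤
        ∑ κ ∈ (T.map s).toFinset, (T.map s).count κ :=
      Finset.sum_le_sum_of_subset (Finset.erase_subset _ _)
    rw [List.sum_toFinset_count_eq_length, List.length_map] at h3
    omega
  obtain ⟨κ, hκ, hcount⟩ := h1
  obtain ⟨hk, hmem⟩ := Finset.mem_erase.1 hκ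
  obtain ⟨b, hb, rfl⟩ := List.mem_map.1 (List.mem_toFinset.1 hmem)
  obtain ⟨A, B, rfl⟩ := List.append_of_mem hb
  rw [List.map_append, List.map_cons, List.count_append, List.count_cons_self] at hcount
  refine ⟨A, b, B, rfl, hk, fun z hz hzb => ?_, fun z hz hzb => ?_⟩
  · have := List.count_pos_iff.2 (hzb ▸ List.mem_map_of_mem (f := s) hz)
    omega
  · have := List.count_pos_iff.2 (hzb ▸ List.mem_map_of_mem (f := s) hz)
    omega

/-- A tree is dismantled leaf by leaf. With so many vertices, some vertex other than the base is the
start of a single letter `b`. Its pair cannot be twisted, since the partner would start there too.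
So the partner ends there, and a letter ending there must be followed by `b`: the partner is the
letter just before `b`. Removing both costs two letters and at most one vertex, so the bound
persists. -/
theorem Walk.reducible {s e : V → K} {π : Equiv.Perm V} {tw : V → Prop} {k : K} {L : List V}
    (hW : Walk s e k L k) (hn : L.Nodup) (hP : PairsWord π L)
    (htw : ∀ x ∈ L, tw (π x) ↔ tw x) (hG : ∀ x ∈ L, Glued s e π tw x)
    (hcard : L.length + 2 ≤ 2 * (vertexSet s k L).card) :
    2 * (vertexSet s k L).card = L.length + 2 ∧ (∀ x ∈ L, ¬ tw x) ∧ Reducible π L := by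
  induction hl : L.length using Nat.strong_induction_on generalizing L with
  | _ n ih =>
  cases L with
  | nil => simp [vertexSet] at hl ⊢; exact ⟨hl.symm, Reducible.nil⟩
  | cons x T =>
    have hk : s x = k := hW.1
    have hvs : vertexSet s k (x :: T) = insert k ((T.map s).toFinset.erase k) := by
      rw [vertexSet, List.map_cons, List.toFinset_cons, hk, Finset.insert_idem]
      ext c; by_cases hc : c = k <;> simp [hc]
    have hlt : T.length < 2 * ((T.map s).toFinset.erase k).card := by
      rw [hvs, Finset.card_insert_of_notMem (by simp), List.length_cons] at hcard
      omega
    obtain ⟨A', b, B, hT, hbk, hA', hB⟩ := exists_simple_value s k T hlt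
    -- The letter `b` lies in the tail, so it has a predecessor `a`, which is `x` itself if `A'` is
    -- empty.
    obtain ⟨A, a, hA⟩ : ∃ A a, x :: A' = A ++ [a] :=
      ⟨_, _, (List.dropLast_append_getLast (List.cons_ne_nil x A')).symm⟩
    have hL : x :: T = A ++ a :: b :: B := by
      rw [hT, ← List.cons_append, hA]; simp
    have hAa : ∀ z ∈ A ++ [a], s z ≠ s b := by
      rw [← hA]
      intro z hz
      rcases List.mem_cons.1 hz with rfl | hz
      · rw [hk]; exact hbk.symm
      · exact hA' z hz
    rw [hL] at hW hn hP htw hG hcard hl ⊢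
    obtain ⟨m, hWA, hma, hab, hWB⟩ := walk_append.1 hW
    have huniq : ∀ z ∈ A ++ a :: b :: B, s z = s b → z = b := by
      intro z hz hzb
      simp only [List.mem_append, List.mem_cons] at hz
      rcases hz with hz | rfl | rfl | hz
      · exact absurd hzb (hAa z (by simp [hz]))
      · exact absurd hzb (hAa z (by simp))
      · rfl
      · exact absurd hzb (hB z hz)
    have hb : b ∈ A ++ a :: b :: B := by simp
    obtain ⟨hb1, hb2, hb3⟩ := hP b hb
    have hutw : ¬ tw b := fun h =>
      hb2 (huniq _ hb1 ((hG b hb).1 h).1.symm)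
    obtain ⟨hg1, hg2⟩ := (hG b hb).2 hutw
    have hba : π b = a := by
      simp only [List.mem_append, List.mem_cons] at hb1
      rcases hb1 with hz | hz | hz | hz
      · exfalso
        rcases hWA.end_mem hz with h | ⟨y, hy, h⟩
        · exact hAa a (by simp) (by rw [hma, hg1, h])
        · exact hAa y (by simp [hy]) (by rw [h, hg1])
      · exact hz
      · exact absurd hz hb2
      · exfalso
        rcases hWB.end_mem hz with h | ⟨y, hy, h⟩
        · exact hbk (by rw [hg1, h])
        · exact hB y hy (by rw [h, hg1])
    have hπa : π a = b := by rw [← hba]; exact hb3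
    have hsub : ∀ z ∈ A ++ B, z ∈ A ++ a :: b :: B := by
      intro z hz
      rcases List.mem_append.1 hz with hz | hz <;> simp [hz]
    have heb : e b = m := by rw [hg2, hba, hma]
    have hWAB : Walk s e k (A ++ B) k := walk_append.2 ⟨m, hWA, by rw [← heb]; exact hWB⟩
    have hm : m ∈ vertexSet s k (A ++ B) := by
      rw [heb] at hWB
      rcases hWB.start_mem with h | ⟨y, hy, h⟩
      · simp [vertexSet, h]
      · simp only [vertexSet, Finset.mem_insert, List.mem_toFinset, List.mem_map]
        exact Or.inr ⟨y, by simp [hy], h⟩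
    -- Only `s b` can disappear: the start `m` of `a` is still visited by the shorter walk.
    have hle : (vertexSet s k (A ++ a :: b :: B)).card ≤ (vertexSet s k (A ++ B)).card + 1 := by
      refine (Finset.card_le_card ?_).trans (Finset.card_insert_le (s b) _)
      intro κ hκ
      simp only [vertexSet, Finset.mem_insert, List.mem_toFinset, List.map_append, List.map_cons,
        List.mem_append, List.mem_cons] at hκ hm ⊢
      rcases hκ with h | h | h | h | h
      · exact Or.inr (Or.inl h)
      · exact Or.inr (Or.inr (Or.inl h))
      · rw [h, hma]; exact Or.inr hm
      · exact Or.inl h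
      · exact Or.inr (Or.inr (Or.inr h))
    have hlen : (A ++ a :: b :: B).length = (A ++ B).length + 2 := by
      simp only [List.length_append, List.length_cons]; omega
    obtain ⟨h1, h2, h3⟩ := ih (A ++ B).length (by omega) hWAB
      (hn.sublist (List.Sublist.append_left
        ((List.sublist_cons_self _ _).trans (List.sublist_cons_self _ _)) _))
      (hP.remove hn hπa) (fun z hz => htw z (hsub z hz)) (fun z hz => hG z (hsub z hz))
      (by omega) rfl
    refine ⟨by omega, ?_, Reducible.insertPair A B a b hπa h3⟩
    intro z hz
    simp only [List.mem_append, List.mem_cons] at hz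
    rcases hz with hz | rfl | rfl | hz
    · exact h2 z (by simp [hz])
    · rw [← hba, htw b hb]; exact hutw
    · exact hutw
    · exact h2 z (by simp [hz])

/-- The extremal gluing is built by growing a tree: each inserted pair runs along a new edge to a
new leaf and back. -/
theorem Reducible.exists_walk [DecidableEq V] {π : Equiv.Perm V} {L : List V} (h : Reducible π L)
    (hn : L.Nodup) (hP : PairsWord π L) :
    ∃ (s e : V → ℕ) (k : ℕ), Walk s e k L k ∧ (∀ x ∈ L, s x = e (π x) ∧ e x = s (π x)) ∧
      2 * (vertexSet s k L).card = L.length + 2 := by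
  induction h with
  | nil => exact ⟨fun _ => 0, fun _ => 0, 0, rfl, by simp, by simp [vertexSet]⟩
  | insertPair A B a b hab h ih =>
    have hba : π b = a := by rw [← hab]; exact (hP a (by simp)).2.2
    have hn' : (A ++ B).Nodup := hn.sublist (List.Sublist.append_left
        ((List.sublist_cons_self _ _).trans (List.sublist_cons_self _ _)) _)
    have hP' := hP.remove hn hab
    obtain ⟨s, e, k, hW, hG, hc⟩ := ih hn' hP'
    obtain ⟨m, hWA, hWB⟩ := walk_append.1 hW
    -- The new leaf `κ`: the letter `a` leads from `m` to `κ`, and `b` leads back.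
    obtain ⟨κ, hκ⟩ := Infinite.exists_notMem_finset (vertexSet s k (A ++ B))
    have hne : a ≠ b := fun h => (hP a (by simp)).2.1 (hab.trans h.symm)
    have hnm : ∀ z ∈ A ++ B, z ≠ a ∧ z ≠ b := by
      intro z hz
      simp only [List.nodup_append, List.nodup_cons, List.mem_cons] at hn
      rcases List.mem_append.1 hz with hz | hz
      · exact ⟨hn.2.2 z hz a (by simp), hn.2.2 z hz b (by simp)⟩
      · exact ⟨fun h => hn.2.1.1 (h ▸ Or.inr hz), fun h => hn.2.1.2.1 (h ▸ hz)⟩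
    let s' : V → ℕ := Function.update (Function.update s a m) b κ
    let e' : V → ℕ := Function.update (Function.update e a κ) b m
    have hs : ∀ z ∈ A ++ B, s' z = s z := fun z hz => by
      simp [s', Function.update_of_ne, hnm z hz]
    have he : ∀ z ∈ A ++ B, e' z = e z := fun z hz => by
      simp [e', Function.update_of_ne, hnm z hz]
    have hsa : s' a = m := by simp [s', Function.update_of_ne hne]
    have hsb : s' b = κ := by simp [s']
    have hea : e' a = κ := by simp [e', Function.update_of_ne hne]
    have heb : e' b = m := by simp [e']
    refine ⟨s', e', k, ?_, ?_, ?_⟩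
    · refine walk_append.2 ⟨m, hWA.congr (fun z hz => hs z (by simp [hz]))
        (fun z hz => he z (by simp [hz])), hsa, hsb.trans hea.symm, ?_⟩
      rw [heb]
      exact hWB.congr (fun z hz => hs z (by simp [hz])) (fun z hz => he z (by simp [hz]))
    · have hAB : ∀ z ∈ A ++ B, s' z = e' (π z) ∧ e' z = s' (π z) := fun z hz => by
        rw [hs z hz, he z hz, hs _ (hP' z hz).1, he _ (hP' z hz).1]
        exact hG z hz
      intro z hz
      simp only [List.mem_append, List.mem_cons] at hz
      rcases hz with hz | rfl | rfl | hz
      · exact hAB z (by simp [hz])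
      · rw [hab, hsa, heb, hea, hsb]; exact ⟨rfl, rfl⟩
      · rw [hba, hsa, heb, hea, hsb]; exact ⟨rfl, rfl⟩
      · exact hAB z (by simp [hz])
    · have hm : m ∈ vertexSet s k (A ++ B) := by
        rcases hWB.start_mem with h | ⟨y, hy, h⟩
        · simp [vertexSet, h]
        · simp only [vertexSet, Finset.mem_insert, List.mem_toFinset, List.mem_map]
          exact Or.inr ⟨y, by simp [hy], h⟩
      have : vertexSet s' k (A ++ a :: b :: B) = insert κ (vertexSet s k (A ++ B)) := by
        have h1 : A.map s' = A.map s := List.map_congr_left fun z hz => hs z (by simp [hz])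
        have h2 : B.map s' = B.map s := List.map_congr_left fun z hz => hs z (by simp [hz])
        ext c
        simp only [vertexSet, Finset.mem_insert, List.mem_toFinset, List.map_append,
          List.map_cons, List.mem_append, List.mem_cons, h1, h2, hsa, hsb] at hm ⊢
        constructor
        · rintro (h | h | h | h | h)
          · exact Or.inr (Or.inl h)
          · exact Or.inr (Or.inr (Or.inl h))
          · rw [h]; exact Or.inr hm
          · exact Or.inl h
          · exact Or.inr (Or.inr (Or.inr h))
        · rintro (h | h | h | h)
          · exact Or.inr (Or.inr (Or.inr (Or.inl h)))
          · exact Or.inl h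
          · exact Or.inr (Or.inl h)
          · exact Or.inr (Or.inr (Or.inr (Or.inr h)))
      rw [this, Finset.card_insert_of_notMem hκ]
      simp only [List.length_append, List.length_cons] at hc ⊢
      omega

end Disc

/-! ### Reducible words and the order form of non-crossing -/

section OrderNonCrossing

variable {V : Type*}

/-- The order formulation of the non-crossing property. -/
def OrderNonCrossing (pos : V → ℕ) (π : Equiv.Perm V) (L : List V) : Prop :=
  ∀ x ∈ L, ∀ y ∈ L, ¬ (pos x < pos y ∧ pos y < pos (π x) ∧ pos (π x) < pos (π y))

/-- No letter lies between two adjacent letters, so an inserted pair crosses nothing. -/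
theorem Reducible.orderNonCrossing {pos : V → ℕ} {π : Equiv.Perm V} {L : List V}
    (h : Reducible π L) (hP : PairsWord π L) (hpos : L.Pairwise fun x y => pos x < pos y) :
    OrderNonCrossing pos π L := by
  induction h with
  | nil => intro x hx; simp at hx
  | insertPair A B a b hab h ih =>
    have hn : (A ++ a :: b :: B).Nodup := hpos.imp fun h => by rintro rfl; exact lt_irrefl _ h
    have hba : π b = a := by rw [← hab]; exact (hP a (by simp)).2.2
    have ih' := ih (hP.remove hn hab) (hpos.sublist (List.Sublist.append_left
        ((List.sublist_cons_self _ _).trans (List.sublist_cons_self _ _)) _))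
    have hbet : ∀ z ∈ A ++ a :: b :: B, ¬ (pos a < pos z ∧ pos z < pos b) := by
      intro z hz
      simp only [List.pairwise_append, List.pairwise_cons, List.mem_cons] at hpos
      simp only [List.mem_append, List.mem_cons] at hz
      rcases hz with hz | rfl | rfl | hz
      · have := hpos.2.2 z hz a (by simp); omega
      · omega
      · omega
      · have := hpos.2.1.2.1 z hz; omega
    have hab' : pos a < pos b := by
      simp only [List.pairwise_append, List.pairwise_cons, List.mem_cons] at hpos
      exact hpos.2.1.1 b (by simp)
    intro x hx y hy hc
    have hxa : x ≠ a := by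
      rintro rfl
      exact hbet y hy (hab ▸ ⟨hc.1, hc.2.1⟩)
    have hxb : x ≠ b := by
      rintro rfl
      rw [hba] at hc; omega
    have hya : y ≠ a := by
      rintro rfl
      exact hbet _ (hP x hx).1 (hab ▸ hc.2)
    have hyb : y ≠ b := by
      rintro rfl
      rw [hba] at hc; omega
    exact ih' x (by simpa [hxa, hxb] using hx) y (by simpa [hya, hyb] using hy) hc

/-- A pair of minimal distance is adjacent: a letter strictly between its points would have its
partner there too, which gives a closer pair. -/
theorem OrderNonCrossing.reducible {pos : V → ℕ} {π : Equiv.Perm V} {L : List V}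
    (h : OrderNonCrossing pos π L) (hP : PairsWord π L)
    (hpos : L.Pairwise fun x y => pos x < pos y) : Reducible π L := by
  induction hl : L.length using Nat.strong_induction_on generalizing L with
  | _ n ih =>
  rcases L.eq_nil_or_concat with rfl | hL
  · exact Reducible.nil
  have hn : L.Nodup := hpos.imp fun h => by rintro rfl; exact lt_irrefl _ h
  have hinj : ∀ x ∈ L, ∀ y ∈ L, pos x = pos y → x = y := by
    have : (L.map pos).Nodup := (List.pairwise_map.2 hpos).imp fun h => h.ne
    exact fun x hx y hy hxy => List.inj_on_of_nodup_map this hx hy hxy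
  have hex : ∃ d, ∃ x ∈ L, pos x + d = pos (π x) ∧ 0 < d := by
    obtain ⟨L', y, rfl⟩ := hL
    have hy := hP y (by simp)
    rcases lt_trichotomy (pos y) (pos (π y)) with h' | h' | h'
    · exact ⟨pos (π y) - pos y, y, by simp, by omega, by omega⟩
    · exact absurd (hinj _ (by simp) _ hy.1 h').symm hy.2.1
    · exact ⟨pos y - pos (π y), π y, hy.1, by rw [hy.2.2]; omega, by omega⟩
  classical
  obtain ⟨x, hx, hd, hd0⟩ := Nat.find_spec hex
  have hmin : ∀ y ∈ L, pos y < pos (π y) → pos (π x) - pos x ≤ pos (π y) - pos y := by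
    intro y hy hlt
    have := Nat.find_min' hex ⟨y, hy, (by omega : pos y + (pos (π y) - pos y) = _), by omega⟩
    omega
  have hlt : pos x < pos (π x) := by omega
  clear hd hd0 hex
  obtain ⟨A, C, rfl⟩ := List.append_of_mem hx
  obtain ⟨hx1, hx2, hx3⟩ := hP x hx
  have hxC : π x ∈ C := by
    have hx1' := hx1
    simp only [List.mem_append, List.mem_cons] at hx1
    rcases hx1 with h' | h' | h'
    · simp only [List.pairwise_append, List.pairwise_cons, List.mem_cons] at hpos
      have := hpos.2.2 _ h' x (by simp); omega
    · exact absurd h' hx2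
    · exact h'
  obtain ⟨M, B, rfl⟩ := List.append_of_mem hxC
  cases M with
  | cons y M =>
    exfalso
    have hy : y ∈ A ++ x :: (y :: M ++ π x :: B) := by simp
    have hxy : pos x < pos y ∧ pos y < pos (π x) := by
      simp only [List.pairwise_append, List.pairwise_cons, List.mem_cons, List.cons_append,
        List.mem_append] at hpos
      exact ⟨hpos.2.1.1 y (by simp), hpos.2.1.2.1 _ (by simp)⟩
    obtain ⟨hy1, hy2, hy3⟩ := hP y hy
    -- The two instances keep `π y` from lying beyond `π x` or before `x`.
    have h1 := h x hx y hy
    have h2 := h (π y) hy1 x hx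
    rw [hy3] at h2
    have h3 := hmin y hy
    have h4 := hmin (π y) hy1
    rw [hy3] at h4
    have h5 : pos (π y) ≠ pos (π x) := fun h' => by
      have := π.injective (hinj _ hy1 _ hx1 h'); rw [this] at hxy; omega
    have h6 : pos (π y) ≠ pos x := fun h' => by
      have := hinj _ hy1 _ hx h'; rw [← this, hy3] at hxy; omega
    have h7 : pos (π y) ≠ pos y := fun h' => hy2 (hinj _ hy1 _ hy h')
    omega
  | nil =>
    have hsub : ∀ z ∈ A ++ B, z ∈ A ++ x :: ([] ++ π x :: B) := by
      intro z hz
      rcases List.mem_append.1 hz with hz | hz <;> simp [hz]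
    refine Reducible.insertPair A B x (π x) rfl (ih (A ++ B).length ?_ ?_ (hP.remove hn rfl)
      (hpos.sublist (List.Sublist.append_left
        ((List.sublist_cons_self _ _).trans (List.sublist_cons_self _ _)) _)) rfl)
    · rw [← hl]; simp
    · exact fun z hz y hy => h z (hsub z hz) y (hsub y hy)

end OrderNonCrossing

/-! ### Gaussian integration by parts for polynomials -/

section Moments

/-- This is `f' = v t f` differentiated `n` times. At `n = 0` the factor `n` kills the term with the
truncated index `n - 1`. -/
theorem iteratedDeriv_exp_sq (v : ℝ) (n : ℕ) :
    iteratedDeriv (n + 1) (fun t : ℝ => Real.exp (v * t ^ 2 / 2)) = fun t =>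
      v * t * iteratedDeriv n (fun t : ℝ => Real.exp (v * t ^ 2 / 2)) t +
        n * v * iteratedDeriv (n - 1) (fun t : ℝ => Real.exp (v * t ^ 2 / 2)) t := by
  set f : ℝ → ℝ := fun t => Real.exp (v * t ^ 2 / 2) with hf
  have hsm : ContDiff ℝ ⊤ f := by fun_prop
  have hd : ∀ n, Differentiable ℝ (iteratedDeriv n f) := fun n =>
    hsm.differentiable_iteratedDeriv n (by exact_mod_cast WithTop.coe_lt_top _)
  induction n with
  | zero =>
    ext t
    have h1 : HasDerivAt (fun t : ℝ => v * t ^ 2 / 2) (v * t) t := by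
      refine (((hasDerivAt_pow 2 t).const_mul v).div_const 2).congr_deriv ?_
      push_cast
      ring
    simp only [zero_add, iteratedDeriv_one, iteratedDeriv_zero, Nat.cast_zero, zero_mul, add_zero]
    rw [hf, h1.exp.deriv, mul_comm]
  | succ n ih =>
    ext t
    rw [iteratedDeriv_succ, ih]
    have h1 : HasDerivAt (fun t => v * t * iteratedDeriv n f t)
        (v * iteratedDeriv n f t + v * t * iteratedDeriv (n + 1) f t) t := by
      have h := ((hasDerivAt_id' t).const_mul v).fun_mul (hd n t).hasDerivAt
      rw [← iteratedDeriv_succ] at h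
      exact h.congr_deriv (by ring)
    have h2 : HasDerivAt (fun t => n * v * iteratedDeriv (n - 1) f t)
        (n * v * iteratedDeriv n f t) t := by
      have h := (hd (n - 1) t).hasDerivAt.const_mul (n * v)
      cases n with
      | zero => simpa using h
      | succ m => rwa [← iteratedDeriv_succ] at h
    rw [(h1.fun_add h2).deriv]
    have ih' := congrFun ih t
    simp only [Nat.add_sub_cancel, Nat.cast_add, Nat.cast_one] at ih' ⊢
    linear_combination v * t * ih'

/-- Moments are derivatives at 0 of the moment generating function `exp (v t ^ 2 / 2)`, and at 0 the
first term of the recursion vanishes. Zero variance is allowed. -/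
theorem integral_pow_succ_of_gaussian {Ω : Type*} [MeasurableSpace Ω] {P : Measure Ω} {X : Ω → ℝ}
    (hX : HasGaussianLaw X P) (h0 : ∫ ω, X ω ∂P = 0) (n : ℕ) :
    ∫ ω, X ω ^ (n + 1) ∂P = n * Var[X; P] * ∫ ω, X ω ^ (n - 1) ∂P := by
  have := hX.isProbabilityMeasure
  have hlaw := hX.map_eq_gaussianReal
  rw [h0] at hlaw
  have hset : integrableExpSet X P = Set.univ := by
    ext t
    simp only [integrableExpSet, Set.mem_ofPred_eq, Set.mem_univ, iff_true]
    have := integrable_exp_mul_gaussianReal (μ := 0) (v := Var[X; P].toNNReal) t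
    rw [← hlaw] at this
    exact this.comp_aemeasurable hX.aemeasurable
  have hmgf : mgf X P = fun t => Real.exp (Var[X; P] * t ^ 2 / 2) := by
    ext t
    rw [mgf_gaussianReal hlaw, Real.coe_toNNReal _ (variance_nonneg _ _)]
    simp
  have hmom : ∀ n : ℕ, ∫ ω, X ω ^ n ∂P =
      iteratedDeriv n (fun t => Real.exp (Var[X; P] * t ^ 2 / 2)) 0 := fun n => by
    rw [← hmgf, iteratedDeriv_mgf_zero (by simp [hset])]
    simp
  rw [hmom, hmom, iteratedDeriv_exp_sq]
  simp

end Moments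

section IntegrationByParts

variable {Ω : Type*} [MeasurableSpace Ω] {P : Measure Ω} {κ : Type*}

/-- All exponents `r` are treated at once, since Hölder's inequality for a product uses exponent `2
* r` for both factors. -/
theorem memLp_eval_mvPolynomial [IsProbabilityMeasure P] {g : κ → Ω → ℝ}
    (hg : ∀ k, HasGaussianLaw (g k) P) (f : MvPolynomial κ ℝ) (r : ℕ) :
    MemLp (fun ω => MvPolynomial.eval (fun k => g k ω) f) r P := by
  induction f using MvPolynomial.induction_on generalizing r with
  | C a => simpa using memLp_const a
  | add p q hp hq => simpa using! (hp r).add (hq r)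
  | mul_X p k hp =>
    have : ENNReal.HolderTriple ((2 * r : ℕ) : ENNReal) ((2 * r : ℕ) : ENNReal) (r : ENNReal) := by
      refine ⟨?_⟩
      push_cast
      rw [ENNReal.mul_inv (by simp) (by simp), ← two_mul, ← mul_assoc,
        ENNReal.mul_inv_cancel (by simp) (by simp), one_mul]
    have h := MemLp.mul' ((hg k).memLp (p := ((2 * r : ℕ) : ENNReal)) (ENNReal.natCast_ne_top _)) (hp (2 * r))
      (r := (r : ENNReal))
    simpa using h

theorem integrable_eval_mvPolynomial [IsProbabilityMeasure P] {g : κ → Ω → ℝ}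
    (hg : ∀ k, HasGaussianLaw (g k) P) (f : MvPolynomial κ ℝ) :
    Integrable (fun ω => MvPolynomial.eval (fun k => g k ω) f) P :=
  memLp_one_iff_integrable.1 (by simpa using memLp_eval_mvPolynomial hg f 1)

variable [Fintype κ]

theorem integral_eval_monomial {g : κ → Ω → ℝ} (hind : iIndepFun g P)
    (hg : ∀ k, HasGaussianLaw (g k) P) (m : κ →₀ ℕ) (a : ℝ) :
    ∫ ω, MvPolynomial.eval (fun k => g k ω) (MvPolynomial.monomial m a) ∂P =
      a * ∏ k, ∫ ω, g k ω ^ m k ∂P := by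
  simp only [MvPolynomial.eval_monomial, integral_const_mul]
  congr 1
  rw [← hind.integral_fun_prod_comp (f := fun k x => x ^ m k) (fun k => (hg k).aemeasurable)
    (fun k => by fun_prop)]
  congr 1 with ω
  rw [Finsupp.prod_fintype _ _ (fun _ => pow_zero _)]

/-- Integration by parts for independent centered Gaussian variables. -/
theorem integral_mul_eval_of_iIndepFun {g : κ → Ω → ℝ} (hind : iIndepFun g P)
    (hg : ∀ k, HasGaussianLaw (g k) P) (h0 : ∀ k, ∫ ω, g k ω ∂P = 0) (k : κ)
    (f : MvPolynomial κ ℝ) :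
    ∫ ω, g k ω * MvPolynomial.eval (fun k => g k ω) f ∂P =
      Var[g k; P] * ∫ ω, MvPolynomial.eval (fun k => g k ω) (MvPolynomial.pderiv k f) ∂P := by
  classical
  have := (hg k).isProbabilityMeasure
  induction f using MvPolynomial.induction_on' with
  | monomial m a =>
    have h1 : ∀ ω, g k ω * MvPolynomial.eval (fun k => g k ω) (MvPolynomial.monomial m a) =
        MvPolynomial.eval (fun k => g k ω)
          (MvPolynomial.monomial (m + Finsupp.single k 1) a) := fun ω => by
      rw [← mul_one a, ← MvPolynomial.monomial_mul, MvPolynomial.eval_mul, mul_one, mul_comm,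
        ← MvPolynomial.X, MvPolynomial.eval_X]
    simp only [h1, MvPolynomial.pderiv_monomial]
    rw [integral_eval_monomial hind hg, integral_eval_monomial hind hg,
      ← Finset.mul_prod_erase _ (fun j => ∫ ω, g j ω ^ ((m + Finsupp.single k 1 : κ →₀ ℕ) j) ∂P)
        (Finset.mem_univ k),
      ← Finset.mul_prod_erase _ (fun j => ∫ ω, g j ω ^ ((m - Finsupp.single k 1 : κ →₀ ℕ) j) ∂P)
        (Finset.mem_univ k)]
    have h2 : ∏ j ∈ Finset.univ.erase k, ∫ ω, g j ω ^ ((m + Finsupp.single k 1 : κ →₀ ℕ) j) ∂P =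
        ∏ j ∈ Finset.univ.erase k, ∫ ω, g j ω ^ ((m - Finsupp.single k 1 : κ →₀ ℕ) j) ∂P := by
      refine Finset.prod_congr rfl fun j hj => ?_
      have hj : k ≠ j := (Finset.ne_of_mem_erase hj).symm
      simp [hj]
    rw [h2]
    simp only [Finsupp.coe_add, Pi.add_apply, Finsupp.single_eq_same, Finsupp.coe_tsub,
      Pi.sub_apply]
    rw [integral_pow_succ_of_gaussian (hg k) (h0 k)]
    ring
  | add p q hp hq =>
    have hX : ∀ p : MvPolynomial κ ℝ,
        Integrable (fun ω => g k ω * MvPolynomial.eval (fun k => g k ω) p) P := fun p => by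
      refine (integrable_eval_mvPolynomial hg (MvPolynomial.X k * p)).congr
        (Eventually.of_forall fun ω => ?_)
      simp
    simp only [map_add, mul_add]
    rw [integral_add (hX p) (hX q), hp, hq, integral_add (integrable_eval_mvPolynomial hg _)
      (integrable_eval_mvPolynomial hg _), mul_add]

/-- A centered Gaussian vector is a linear image of a vector of independent centered Gaussian
variables. -/
theorem exists_iIndepFun_of_gaussian {ξ : κ → Ω → ℝ} (hξ : HasGaussianLaw (fun ω a => ξ a ω) P)
    (h0 : ∀ a, ∫ ω, ξ a ω ∂P = 0) :
    ∃ (g : κ → Ω → ℝ) (U : Matrix κ κ ℝ), iIndepFun g P ∧ (∀ k, HasGaussianLaw (g k) P) ∧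
      (∀ k, ∫ ω, g k ω ∂P = 0) ∧ ∀ a ω, ξ a ω = ∑ k, U a k * g k ω := by
  classical
  have := hξ.isProbabilityMeasure
  have hmem : ∀ a, MemLp (ξ a) 2 P := fun a => (hξ.eval a).memLp_two
  -- The covariance matrix is diagonalized by an orthogonal `U`. The coordinates `Uᵀ ξ` are jointly
  -- Gaussian and uncorrelated, hence independent; no invertibility is needed, which matters for `γ
  -- = ±1`.
  let A : Matrix κ κ ℝ := Matrix.of fun a b => cov[ξ a, ξ b; P]
  have hA : A.IsHermitian := by
    ext a b
    simp [A, covariance_comm]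
  let U : Matrix κ κ ℝ := hA.eigenvectorUnitary
  have hU : U * Uᵀ = 1 := by
    have := Unitary.coe_mul_star_self hA.eigenvectorUnitary
    simpa [Matrix.star_eq_conjTranspose] using this
  have hD : Uᵀ * A * U = Matrix.diagonal hA.eigenvalues := by
    have := hA.conjStarAlgAut_star_eigenvectorUnitary
    rw [Unitary.conjStarAlgAut_star_apply] at this
    simpa [Matrix.star_eq_conjTranspose, Function.comp_def] using this
  let g : κ → Ω → ℝ := fun k ω => ∑ a, U a k * ξ a ω
  have hgl : HasGaussianLaw (fun ω k => g k ω) P := by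
    have := hξ.map_fun (LinearMap.toContinuousLinearMap (Matrix.toLin' Uᵀ))
    have h : (fun ω k => g k ω) = fun ω =>
        LinearMap.toContinuousLinearMap (Matrix.toLin' Uᵀ) fun a => ξ a ω := by
      ext ω k
      simp [g, Matrix.mulVec, dotProduct]
    rw [h]
    exact this
  refine ⟨g, U, hgl.iIndepFun_of_covariance_eq_zero fun k l hkl => ?_, fun k => hgl.eval k,
    fun k => ?_, fun a ω => ?_⟩
  · have h1 : cov[g k, g l; P] = (Uᵀ * A * U) k l := by
      have e1 : g k = ∑ a, fun ω => U a k * ξ a ω := by ext ω; simp [g]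
      have e2 : g l = ∑ a, fun ω => U a l * ξ a ω := by ext ω; simp [g]
      rw [e1, e2, covariance_sum_sum (fun a => (hmem a).const_mul _)
        (fun a => (hmem a).const_mul _)]
      simp only [covariance_const_mul_left, covariance_const_mul_right, Matrix.mul_apply,
        Matrix.transpose_apply, Finset.sum_mul, A, Matrix.of_apply]
      rw [Finset.sum_comm]
      refine Finset.sum_congr rfl fun a _ => Finset.sum_congr rfl fun b _ => ?_
      ring
    rw [h1, hD, Matrix.diagonal_apply_ne _ hkl]
  · simp only [g]
    rw [integral_finsetSum _ fun a _ => ((hmem a).integrable (by norm_num)).const_mul _]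
    simp [integral_const_mul, h0]
  · have h1 := congrArg (fun M => (M *ᵥ fun a => ξ a ω) a) hU
    simp only [← Matrix.mulVec_mulVec, Matrix.one_mulVec] at h1
    rw [← h1]
    simp [Matrix.mulVec, dotProduct, g]

theorem derivation_prod {R A ι : Type*} [CommRing R] [CommRing A] [Algebra R A] [DecidableEq ι]
    (D : Derivation R A A) (S : Finset ι) (f : ι → A) :
    D (∏ i ∈ S, f i) = ∑ i ∈ S, D (f i) * ∏ j ∈ S.erase i, f j := by
  induction S using Finset.induction_on with
  | empty => simp
  | insert a S ha ih =>
    rw [Finset.prod_insert ha, Derivation.leibniz, ih, Finset.sum_insert ha,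
      Finset.erase_insert ha, smul_eq_mul, smul_eq_mul, Finset.mul_sum, add_comm, mul_comm]
    congr 1
    refine Finset.sum_congr rfl fun i hi => ?_
    have hia : a ≠ i := by rintro rfl; exact ha hi
    rw [Finset.erase_insert_of_ne hia, Finset.prod_insert (by simp [ha])]
    ring

/-- Integration by parts for the components of a centered Gaussian vector. -/
theorem integral_mul_prod_of_gaussian {ξ : κ → Ω → ℝ}
    (hξ : HasGaussianLaw (fun ω a => ξ a ω) P) (h0 : ∀ a, ∫ ω, ξ a ω ∂P = 0)
    {V : Type*} [DecidableEq V] (S : Finset V) (c : V → κ) (a : κ) :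
    ∫ ω, ξ a ω * ∏ x ∈ S, ξ (c x) ω ∂P =
      ∑ y ∈ S, (∫ ω, ξ a ω * ξ (c y) ω ∂P) * ∫ ω, ∏ x ∈ S.erase y, ξ (c x) ω ∂P := by
  classical
  have := hξ.isProbabilityMeasure
  obtain ⟨g, U, hind, hg, hg0, hU⟩ := exists_iIndepFun_of_gaussian hξ h0
  let ℓ : κ → MvPolynomial κ ℝ := fun a => ∑ k, MvPolynomial.C (U a k) * MvPolynomial.X k
  have hℓ : ∀ a ω, ξ a ω = MvPolynomial.eval (fun k => g k ω) (ℓ a) := fun a ω => by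
    simp [ℓ, hU]
  have hd : ∀ a k, MvPolynomial.pderiv k (ℓ a) = MvPolynomial.C (U a k) := fun a k => by
    simp [ℓ, Derivation.leibniz, MvPolynomial.pderiv_X, Pi.single_apply]
  have key : ∀ f : MvPolynomial κ ℝ, ∫ ω, ξ a ω * MvPolynomial.eval (fun k => g k ω) f ∂P =
      ∑ k, U a k * (Var[g k; P] *
        ∫ ω, MvPolynomial.eval (fun k => g k ω) (MvPolynomial.pderiv k f) ∂P) := fun f => by
    simp only [hU, Finset.sum_mul, mul_assoc]
    rw [integral_finsetSum]
    · refine Finset.sum_congr rfl fun k _ => ?_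
      rw [integral_const_mul, integral_mul_eval_of_iIndepFun hind hg hg0]
    · intro k _
      refine Integrable.const_mul ?_ _
      refine (integrable_eval_mvPolynomial hg (MvPolynomial.X k * f)).congr
        (Eventually.of_forall fun ω => ?_)
      simp
  have h1 : ∀ T : Finset V, ∀ ω, ∏ x ∈ T, ξ (c x) ω =
      MvPolynomial.eval (fun k => g k ω) (∏ x ∈ T, ℓ (c x)) := fun T ω => by
    simp [hℓ]
  -- The case of a linear `f` recovers the covariances of `ξ` from `U` and the variances of `g`.
  have h2 : ∀ b, ∫ ω, ξ a ω * ξ b ω ∂P = ∑ k, U a k * (Var[g k; P] * U b k) := fun b => by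
    have := key (ℓ b)
    simpa [← hℓ, hd] using this
  simp only [h1, h2, key, derivation_prod, hd, map_sum, map_mul, MvPolynomial.eval_C]
  simp only [Finset.sum_mul]
  rw [Finset.sum_comm]
  refine Finset.sum_congr rfl fun k _ => ?_
  rw [integral_finsetSum, Finset.mul_sum, Finset.mul_sum]
  · refine Finset.sum_congr rfl fun y _ => ?_
    rw [integral_const_mul]
    ring
  · intro y _
    exact (integrable_eval_mvPolynomial hg _).const_mul _

end IntegrationByParts

/-! ### The entries of a real Gaussian elliptic matrix -/

section Entries

/-- The covariance of the entries `a` and `b` of a real Gaussian elliptic matrix. -/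
noncomputable def entryCov {N : ℕ} (γ : ℝ) (a b : Fin N × Fin N) : ℝ :=
  (if a.1 = b.1 ∧ a.2 = b.2 then 1 else 0) + γ * (if a.1 = b.2 ∧ a.2 = b.1 then 1 else 0)

variable {Ω : Type*} [MeasurableSpace Ω] {P : Measure Ω} {N : ℕ} {γ : ℝ}
  {G : Ω → Matrix (Fin N) (Fin N) ℝ}

/-- Independent Gaussian pairs are jointly Gaussian, and every entry is a coordinate of the pair
indexed by its sorted position. -/
theorem IsRealGaussianElliptic.hasGaussianLaw (hG : IsRealGaussianElliptic γ G P) :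
    HasGaussianLaw (fun ω (a : Fin N × Fin N) => G ω a.1 a.2) P := by
  have h1 := hG.indep.hasGaussianLaw (fun e => by
    rcases e.2.eq_or_lt with h | h
    · have := (hG.gaussian_diag e.1.1).map_fun
        ((ContinuousLinearMap.id ℝ ℝ).prod (ContinuousLinearMap.id ℝ ℝ))
      rw [← h]
      exact this
    · exact hG.gaussian_offDiag _ _ h)
  let E : ∀ e : {e : Fin N × Fin N // e.1 ≤ e.2}, ({e : Fin N × Fin N // e.1 ≤ e.2} → ℝ × ℝ) →L[ℝ] ℝ × ℝ :=
    fun e => ContinuousLinearMap.proj e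
  have h2 := h1.map_fun (ContinuousLinearMap.pi fun a : Fin N × Fin N =>
    if h : a.1 ≤ a.2 then (ContinuousLinearMap.fst ℝ ℝ ℝ).comp (E ⟨a, h⟩)
    else (ContinuousLinearMap.snd ℝ ℝ ℝ).comp (E ⟨a.swap, (not_le.1 h).le⟩))
  refine h2.congr (Eventually.of_forall fun ω => ?_)
  ext a
  by_cases h : a.1 ≤ a.2 <;> simp [h, E]

theorem IsRealGaussianElliptic.integral_mul (hG : IsRealGaussianElliptic γ G P)
    (a b : Fin N × Fin N) : ∫ ω, G ω a.1 a.2 * G ω b.1 b.2 ∂P = entryCov γ a b := by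
  obtain ⟨i, j⟩ := a
  obtain ⟨k, l⟩ := b
  simp only [entryCov]
  by_cases h1 : i = k ∧ j = l
  · obtain ⟨rfl, rfl⟩ := h1
    by_cases hij : i = j
    · subst hij
      simpa [sq] using hG.sq_diag i
    · simpa [sq, hij] using hG.sq_offDiag i j hij
  by_cases h2 : i = l ∧ j = k
  · obtain ⟨rfl, rfl⟩ := h2
    have hij : i ≠ j := fun h => h1 ⟨h, h.symm⟩
    simpa [hij] using hG.mul_offDiag i j hij
  simp only [h1, h2, if_false, mul_zero, add_zero]
  -- In the remaining case `{i, j} ≠ {k, l}`, so the two entries are functions of different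
  -- independent pairs.
  let e : Fin N → Fin N → {e : Fin N × Fin N // e.1 ≤ e.2} := fun i j =>
    ⟨(min i j, max i j), min_le_max⟩
  have hne : e i j ≠ e k l := by
    intro h
    have h3 : min i j = min k l := congrArg (fun e => e.1.1) h
    have h4 : max i j = max k l := congrArg (fun e => e.1.2) h
    rcases le_total i j with hij | hij <;> rcases le_total k l with hkl | hkl <;>
      simp only [min_eq_left, min_eq_right, max_eq_left, max_eq_right, hij, hkl] at h3 h4
    · exact h1 ⟨h3, h4⟩
    · exact h2 ⟨h3, h4⟩
    · exact h2 ⟨h4, h3⟩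
    · exact h1 ⟨h4, h3⟩
  have hφ : ∀ i j : Fin N, ∃ φ : ℝ × ℝ → ℝ, Measurable φ ∧ ∀ ω, G ω i j =
      φ (G ω (e i j).1.1 (e i j).1.2, G ω (e i j).1.2 (e i j).1.1) := by
    intro i j
    rcases le_total i j with hij | hij
    · exact ⟨Prod.fst, measurable_fst, fun ω => by simp [e, hij]⟩
    · exact ⟨Prod.snd, measurable_snd, fun ω => by simp [e, hij]⟩
  obtain ⟨φ, hφm, hφ1⟩ := hφ i j
  obtain ⟨ψ, hψm, hψ1⟩ := hφ k l
  have hI : IndepFun (fun ω => G ω i j) (fun ω => G ω k l) P := by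
    have := (hG.indep.indepFun hne).comp hφm hψm
    simp only [Function.comp_def, ← hφ1, ← hψ1] at this
    exact this
  rw [hI.integral_fun_mul_eq_mul_integral
    (hG.hasGaussianLaw.eval (i, j)).aemeasurable.aestronglyMeasurable
    (hG.hasGaussianLaw.eval (k, l)).aemeasurable.aestronglyMeasurable]
  simp [hG.centered]

theorem IsRealGaussianElliptic.integral_mul_prod (hG : IsRealGaussianElliptic γ G P)
    {V : Type*} [DecidableEq V] (S : Finset V) (c : V → Fin N × Fin N) (a : Fin N × Fin N) :
    ∫ ω, G ω a.1 a.2 * ∏ x ∈ S, G ω (c x).1 (c x).2 ∂P =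
      ∑ y ∈ S, entryCov γ a (c y) * ∫ ω, ∏ x ∈ S.erase y, G ω (c x).1 (c x).2 ∂P := by
  simp only [← hG.integral_mul]
  exact integral_mul_prod_of_gaussian (ξ := fun a ω => G ω a.1 a.2) hG.hasGaussianLaw
    (fun a => hG.centered _ _) S c a

end Entries

/-! ### Sums over pair partitions -/

section Wick

variable {V : Type*} [Fintype V]

/-- The first points of the pairs of `π`, with respect to the order given by `key`. -/
def firsts (key : V → ℕ) (π : Equiv.Perm V) : Finset V :=
  Finset.univ.filter fun x => key x < key (π x)

theorem mem_firsts {key : V → ℕ} {π : Equiv.Perm V} {x : V} :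
    x ∈ firsts key π ↔ key x < key (π x) := by
  simp [firsts]

variable [DecidableEq V]

/-- The pair partitions of the subset `S`, extended by the identity. -/
def pairPerms (S : Finset V) : Finset (Equiv.Perm V) :=
  Finset.univ.filter fun π => (∀ x, π (π x) = x) ∧ ∀ x, π x ≠ x ↔ x ∈ S

theorem mem_pairPerms {S : Finset V} {π : Equiv.Perm V} :
    π ∈ pairPerms S ↔ (∀ x, π (π x) = x) ∧ ∀ x, π x ≠ x ↔ x ∈ S := by
  simp [pairPerms]

theorem swap_mul_apply_of_pairPerms {S : Finset V} {a b : V} {π : Equiv.Perm V}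
    (hπ : π ∈ pairPerms (S.erase b)) (ha : a ∉ S) :
    (Equiv.swap a b * π) a = b ∧ (Equiv.swap a b * π) b = a ∧
      ∀ z, z ≠ a → z ≠ b → (Equiv.swap a b * π) z = π z := by
  obtain ⟨h1, h2⟩ := mem_pairPerms.1 hπ
  have ha' : π a = a := by
    by_contra h; exact ha (Finset.mem_of_mem_erase ((h2 a).1 h))
  have hb' : π b = b := by
    by_contra h; exact Finset.notMem_erase b S ((h2 b).1 h)
  refine ⟨by simp [ha'], by simp [hb'], fun z hza hzb => ?_⟩
  rw [Equiv.Perm.mul_apply, Equiv.swap_apply_of_ne_of_ne]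
  · exact fun h => hza (π.injective (h.trans ha'.symm))
  · exact fun h => hzb (π.injective (h.trans hb'.symm))

/-- A partition of `insert a S` amounts to the partner `y` of `a` and a partition of the rest;
multiplication by the transposition of `a` and `y` passes between them. Minimality of `a` makes it
the first point of its pair, so `C` need not be symmetric. -/
theorem sum_pairPerms_insert {R : Type*} [CommSemiring R] {key : V → ℕ}
    (hkey : Function.Injective key) (C : V → V → R) {S : Finset V} {a : V} (ha : a ∉ S)
    (hmin : ∀ y ∈ S, key a ≤ key y) :
    ∑ π ∈ pairPerms (insert a S), ∏ x ∈ firsts key π, C x (π x) =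
      ∑ y ∈ S, C a y * ∑ π ∈ pairPerms (S.erase y), ∏ x ∈ firsts key π, C x (π x) := by
  simp only [Finset.mul_sum]
  rw [Finset.sum_sigma']
  symm
  refine Finset.sum_bij' (fun yπ _ => Equiv.swap a yπ.1 * yπ.2)
    (fun π _ => ⟨π a, Equiv.swap a (π a) * π⟩) ?_ ?_ ?_ ?_ ?_
  · rintro ⟨b, π⟩ h
    obtain ⟨hb, hπ⟩ := Finset.mem_sigma.1 h
    obtain ⟨e1, e2, e3⟩ := swap_mul_apply_of_pairPerms hπ ha
    obtain ⟨h1, h2⟩ := mem_pairPerms.1 hπ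
    have hab : a ≠ b := by rintro rfl; exact ha hb
    refine mem_pairPerms.2 ⟨fun x => ?_, fun x => ?_⟩
    · by_cases hxa : x = a
      · subst hxa; dsimp only at *; rw [e1, e2]
      by_cases hxb : x = b
      · subst hxb; dsimp only at *; rw [e2, e1]
      have h3 : π a = a := by
        by_contra h; exact ha (Finset.mem_of_mem_erase ((h2 a).1 h))
      have h4 : π b = b := by
        by_contra h; exact Finset.notMem_erase b S ((h2 b).1 h)
      dsimp only at *
      rw [e3 x hxa hxb, e3 _ (fun h => hxa (π.injective (h.trans h3.symm)))
        (fun h => hxb (π.injective (h.trans h4.symm))), h1]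
    · dsimp only at *
      by_cases hxa : x = a
      · subst hxa; rw [e1]; simp [hab.symm]
      by_cases hxb : x = b
      · subst hxb; rw [e2]; simp [hab, hb]
      rw [e3 x hxa hxb, h2]
      simp [hxa, hxb]
  · intro π hπ
    obtain ⟨h1, h2⟩ := mem_pairPerms.1 hπ
    have hne : π a ≠ a := (h2 a).2 (by simp)
    have hmem : π a ∈ S := by
      have := (h2 (π a)).1 (by rw [h1]; exact hne.symm)
      simpa [hne] using this
    have e3 : ∀ x, x ≠ a → x ≠ π a → (Equiv.swap a (π a) * π) x = π x := fun x hxa hxb => by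
      rw [Equiv.Perm.mul_apply, Equiv.swap_apply_of_ne_of_ne]
      · exact fun h => hxb (by rw [← h, h1])
      · exact fun h => hxa (π.injective h)
    have ea : (Equiv.swap a (π a) * π) a = a := by simp
    have eb : (Equiv.swap a (π a) * π) (π a) = π a := by simp [h1]
    refine Finset.mem_sigma.2 ⟨hmem, mem_pairPerms.2 ⟨fun x => ?_, fun x => ?_⟩⟩ <;> dsimp only
    · by_cases hxa : x = a
      · rw [hxa, ea, ea]
      by_cases hxb : x = π a
      · rw [hxb, eb, eb]
      rw [e3 x hxa hxb, e3 _ (fun h => hxb (by rw [← h, h1])) (fun h => hxa (π.injective h)), h1]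
    · by_cases hxa : x = a
      · rw [hxa, ea]; simp [ha]
      by_cases hxb : x = π a
      · rw [hxb, eb]; simp
      rw [e3 x hxa hxb, h2]
      simp [hxa, hxb]
  · rintro ⟨b, π⟩ h
    obtain ⟨hb, hπ⟩ := Finset.mem_sigma.1 h
    obtain ⟨e1, -, -⟩ := swap_mul_apply_of_pairPerms hπ ha
    dsimp only at e1 ⊢
    rw [e1, ← mul_assoc, Equiv.swap_mul_self, one_mul]
  · intro π _
    dsimp only
    rw [← mul_assoc, Equiv.swap_mul_self, one_mul]
  · rintro ⟨b, π⟩ h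
    obtain ⟨hb, hπ⟩ := Finset.mem_sigma.1 h
    obtain ⟨e1, e2, e3⟩ := swap_mul_apply_of_pairPerms hπ ha
    dsimp only at e1 e2 e3 hb hπ ⊢
    obtain ⟨h1, h2⟩ := mem_pairPerms.1 hπ
    have hab : a ≠ b := by rintro rfl; exact ha hb
    have hlt : key a < key b := lt_of_le_of_ne (hmin b hb) fun h => hab (hkey h)
    have h3 : π a = a := by
      by_contra h; exact ha (Finset.mem_of_mem_erase ((h2 a).1 h))
    have h4 : π b = b := by
      by_contra h; exact Finset.notMem_erase b S ((h2 b).1 h)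
    have hf : firsts key (Equiv.swap a b * π) = insert a (firsts key π) := by
      ext x
      rw [mem_firsts, Finset.mem_insert, mem_firsts]
      by_cases hxa : x = a
      · subst hxa; rw [e1]; simp [hlt]
      by_cases hxb : x = b
      · subst hxb; rw [e2, h4]; simp [hxa, hlt.le]
      rw [e3 x hxa hxb]; simp [hxa]
    rw [hf, Finset.prod_insert (by simp [mem_firsts, h3]), e1]
    congr 1
    refine Finset.prod_congr rfl fun x hx => ?_
    rw [mem_firsts] at hx
    rw [e3 x (by rintro rfl; rw [h3] at hx; exact lt_irrefl _ hx)
      (by rintro rfl; rw [h4] at hx; exact lt_irrefl _ hx)]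

/-- The recursion given by integration by parts is solved by a sum over pair partitions. -/
theorem eq_sum_pairPerms {R : Type*} [CommSemiring R] {key : V → ℕ}
    (hkey : Function.Injective key) (C : V → V → R) (M : Finset V → R) (h0 : M ∅ = 1)
    (hM : ∀ S a, a ∉ S → M (insert a S) = ∑ y ∈ S, C a y * M (S.erase y)) (S : Finset V) :
    M S = ∑ π ∈ pairPerms S, ∏ x ∈ firsts key π, C x (π x) := by
  induction hn : S.card using Nat.strong_induction_on generalizing S with
  | _ n ih =>
  rcases S.eq_empty_or_nonempty with rfl | hS
  · have : pairPerms (∅ : Finset V) = {1} := by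
      ext π
      simp only [mem_pairPerms, Finset.notMem_empty, iff_false, not_not, Finset.mem_singleton]
      exact ⟨fun h => Equiv.ext h.2, by rintro rfl; simp⟩
    simp [this, h0, firsts]
  · obtain ⟨a, ha, hmin⟩ := S.exists_min_image key hS
    rw [← Finset.insert_erase ha, hM _ _ (Finset.notMem_erase a S),
      sum_pairPerms_insert hkey C (Finset.notMem_erase a S)
        (fun y hy => hmin y (Finset.mem_of_mem_erase hy))]
    refine Finset.sum_congr rfl fun y hy => ?_
    have h1 := Finset.card_erase_of_mem hy
    have h2 := Finset.card_erase_of_mem ha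
    have h3 := Finset.card_pos.2 hS
    rw [ih _ (by omega) ((S.erase a).erase y) rfl]

end Wick

/-! ### The trace of a word as a sum over index functions -/

section Trace

variable {ι R : Type*} [Fintype ι] [DecidableEq ι] [CommSemiring R]

/-- The `m` inner indices `f`, preceded by `a`, are the row indices; followed by `b`, they are the
column indices. For the trace, `a = b` makes the second list a rotation of the first. -/
theorem prod_ofFn_apply (m : ℕ) (M : Fin (m + 1) → Matrix ι ι R) (a b : ι) :
    (List.ofFn M).prod a b = ∑ f : Fin m → ι, ∏ t : Fin (m + 1),
      M t ((Fin.cons a f : Fin (m + 1) → ι) t) ((Fin.snoc f b : Fin (m + 1) → ι) t) := by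
  induction m generalizing a with
  | zero => simp [Fin.snoc]
  | succ m ih =>
    rw [List.ofFn_succ, List.prod_cons, Matrix.mul_apply]
    rw [← Fintype.sum_equiv (Fin.consEquiv fun _ : Fin (m + 1) => ι)
      (fun cf : ι × (Fin m → ι) => ∏ t : Fin (m + 2),
        M t ((Fin.cons a (Fin.cons cf.1 cf.2 : Fin (m + 1) → ι) : Fin (m + 2) → ι) t)
          ((Fin.snoc (Fin.cons cf.1 cf.2 : Fin (m + 1) → ι) b : Fin (m + 2) → ι) t)) _
      (fun cf => rfl)]
    rw [Fintype.sum_prod_type]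
    refine Finset.sum_congr rfl fun c _ => ?_
    rw [ih, Finset.mul_sum]
    refine Finset.sum_congr rfl fun f _ => ?_
    rw [Fin.prod_univ_succ (n := m + 1), ← Fin.cons_snoc_eq_snoc_cons]
    simp

theorem trace_prod_ofFn {n : ℕ} (hn : 1 ≤ n) (M : Fin n → Matrix ι ι R) :
    (List.ofFn M).prod.trace = ∑ i : Fin n → ι, ∏ t, M t (i t) (i (finRotate n t)) := by
  obtain ⟨m, rfl⟩ : ∃ m, n = m + 1 := ⟨n - 1, by omega⟩
  rw [Matrix.trace, ← Fintype.sum_equiv (Fin.consEquiv fun _ : Fin (m + 1) => ι)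
      (fun cf : ι × (Fin m → ι) => ∏ t : Fin (m + 1),
        M t ((Fin.cons cf.1 cf.2 : Fin (m + 1) → ι) t)
          ((Fin.cons cf.1 cf.2 : Fin (m + 1) → ι) (finRotate (m + 1) t))) _
      (fun cf => rfl), Fintype.sum_prod_type]
  refine Finset.sum_congr rfl fun a _ => ?_
  rw [Matrix.diag_apply, prod_ofFn_apply]
  refine Finset.sum_congr rfl fun f _ => Finset.prod_congr rfl fun t _ => ?_
  rw [Fin.snoc_eq_cons_rotate]

/-- The entry of `A` that occurs for the letter `l` between the indices `a` and `b`. -/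
def Letter.entry (l : Letter) (a b : ι) : ι × ι :=
  match l with
  | .one => (a, b)
  | .star => (b, a)

theorem traceWord_normalized {n N : ℕ} (hn : 1 ≤ n) (w : Fin n → Letter)
    (A : Matrix (Fin N) (Fin N) ℝ) :
    traceWord w (normalized A) = (1 / √(N : ℝ)) ^ n * ∑ i : Fin n → Fin N,
      ∏ t, A ((w t).entry (i t) (i (finRotate n t))).1 ((w t).entry (i t) (i (finRotate n t))).2 := by
  rw [traceWord, trace_prod_ofFn hn, Finset.mul_sum]
  refine Finset.sum_congr rfl fun i _ => ?_
  have : ∀ t, (w t).apply (normalized A) (i t) (i (finRotate n t)) = (1 / √(N : ℝ)) *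
      A ((w t).entry (i t) (i (finRotate n t))).1 ((w t).entry (i t) (i (finRotate n t))).2 := by
    intro t
    cases w t <;> simp [Letter.apply, Letter.entry, normalized]
  simp only [this, Finset.prod_mul_distrib, Finset.prod_const, Finset.card_univ, Fintype.card_fin]

end Trace

/-! ### Vertices of a gluing -/

section Vertices

variable {V K : Type*}

/-- The index functions `i` that are compatible with the gluing of the letters along `π`, where the
letter `x` leads from the index `i x` to the index `i (ρ x)`. -/
def Coloring (ρ π : Equiv.Perm V) (tw : V → Prop) (i : V → K) : Prop :=
  ∀ x, Glued i (fun y => i (ρ y)) π tw x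

/-- The identifications of indices caused by the gluing along `π`. -/
def GlueRel (ρ π : Equiv.Perm V) (tw : V → Prop) (a b : V) : Prop :=
  ∃ x, (tw x ∧ (a = x ∧ b = π x ∨ a = ρ x ∧ b = ρ (π x))) ∨
    (¬ tw x ∧ (a = x ∧ b = ρ (π x) ∨ a = ρ x ∧ b = π x))

theorem coloring_iff {ρ π : Equiv.Perm V} {tw : V → Prop} {i : V → K} :
    Coloring ρ π tw i ↔ ∀ a b, GlueRel ρ π tw a b → i a = i b := by
  constructor
  · rintro h a b ⟨x, ⟨ht, ⟨rfl, rfl⟩ | ⟨rfl, rfl⟩⟩ | ⟨ht, ⟨rfl, rfl⟩ | ⟨rfl, rfl⟩⟩⟩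
    · exact ((h a).1 ht).1
    · exact ((h x).1 ht).2
    · exact ((h a).2 ht).1
    · exact ((h x).2 ht).2
  · intro h x
    exact ⟨fun ht => ⟨h _ _ ⟨x, Or.inl ⟨ht, Or.inl ⟨rfl, rfl⟩⟩⟩,
      h _ _ ⟨x, Or.inl ⟨ht, Or.inr ⟨rfl, rfl⟩⟩⟩⟩, fun ht =>
      ⟨h _ _ ⟨x, Or.inr ⟨ht, Or.inl ⟨rfl, rfl⟩⟩⟩, h _ _ ⟨x, Or.inr ⟨ht, Or.inr ⟨rfl, rfl⟩⟩⟩⟩⟩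

/-- The number of vertices of the surface glued along `π`. -/
noncomputable def numVertices (ρ π : Equiv.Perm V) (tw : V → Prop) : ℕ :=
  Nat.card (Quot (GlueRel ρ π tw))

/-- Compatible index functions are exactly the functions on the quotient by the identifications. -/
theorem card_coloring [Finite V] (ρ π : Equiv.Perm V) (tw : V → Prop) (K : Type*) [Finite K] :
    Nat.card {i : V → K // Coloring ρ π tw i} = Nat.card K ^ numVertices ρ π tw := by
  rw [numVertices, ← Nat.card_fun]
  refine Nat.card_congr
    { toFun := fun i => Quot.lift i.1 (coloring_iff.1 i.2)
      invFun := fun f => ⟨fun x => f (Quot.mk _ x), coloring_iff.2 fun a b h => by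
        rw [Quot.sound h]⟩
      left_inv := fun i => rfl
      right_inv := fun f => by
        ext x
        induction x using Quot.ind
        rfl }

theorem coloring_mk (ρ π : Equiv.Perm V) (tw : V → Prop) :
    Coloring ρ π tw (Quot.mk (GlueRel ρ π tw)) :=
  coloring_iff.2 fun _ _ h => Quot.sound h

/-- A colouring factors through the vertices, so any colouring bounds their number from below by the
number of colours used. -/
theorem card_le_numVertices [Finite V] {ρ π : Equiv.Perm V} {tw : V → Prop} {i : V → K}
    (h : Coloring ρ π tw i) (S : Finset K) (hS : ∀ κ ∈ S, ∃ x, i x = κ) :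
    S.card ≤ numVertices ρ π tw := by
  have : Finite (Quot (GlueRel ρ π tw)) := Finite.of_surjective _ Quot.mk_surjective
  choose x hx using hS
  rw [numVertices, ← Fintype.card_coe, ← Nat.card_eq_fintype_card]
  refine Nat.card_le_card_of_injective
    (fun κ : S => Quot.mk (GlueRel ρ π tw) (x κ.1 κ.2)) fun κ κ' hκ => Subtype.ext ?_
  rw [← hx κ.1 κ.2, ← hx κ'.1 κ'.2]
  exact congrArg (Quot.lift i (coloring_iff.1 h)) hκ

end Vertices

/-! ### Walks along an arc of consecutive points -/

section Paths

variable {V K : Type*} {s e : V → K}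

theorem walk_map_range (f : ℕ → V) (m : ℕ)
    (h : ∀ j < m, e (f j) = s (f (j + 1))) :
    Walk s e (s (f 0)) ((List.range m).map f) (s (f m)) := by
  induction m with
  | zero => exact rfl
  | succ m ih =>
    rw [List.range_succ, List.map_append]
    exact walk_append.2 ⟨_, ih fun j hj => h j (by omega), rfl, h m (by omega)⟩

theorem Walk.eq_of_map_range {f : ℕ → V} {m : ℕ} {k k' : K}
    (h : Walk s e k ((List.range m).map f) k') {i : V → K} (hi : ∀ j < m, i (f j) = s (f j))
    (hm : i (f m) = k') : i (f 0) = k ∧ ∀ j < m, e (f j) = i (f (j + 1)) := by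
  induction m generalizing k' with
  | zero => exact ⟨hm.trans (Eq.symm h), by simp⟩
  | succ m ih =>
    rw [List.range_succ, List.map_append] at h
    obtain ⟨c, h1, h2, h3⟩ := walk_append.1 h
    obtain ⟨h4, h5⟩ := ih h1 (fun j hj => hi j (by omega)) ((hi m (by omega)).trans h2)
    refine ⟨h4, fun j hj => ?_⟩
    rcases Nat.lt_succ_iff_lt_or_eq.1 hj with hj | rfl
    · exact h5 j hj
    · exact Eq.trans h3 hm.symm

end Paths

/-! ### The annulus cut along a spoke -/

section Annulus

variable {p q : ℕ}

/-- The rotation of the two circles of the annulus. -/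
def rot (p q : ℕ) : Equiv.Perm (Fin p ⊕ Fin q) := Equiv.sumCongr (finRotate p) (finRotate q)

theorem rot_pow_inl (k : ℕ) (i : Fin p) :
    (rot p q ^ k) (.inl i) = .inl ((finRotate p ^ k) i) := by
  induction k with
  | zero => rfl
  | succ k ih => rw [pow_succ', Equiv.Perm.mul_apply, ih, pow_succ', Equiv.Perm.mul_apply]; rfl

theorem rot_pow_inr (k : ℕ) (j : Fin q) :
    (rot p q ^ k) (.inr j) = .inr ((finRotate q ^ k) j) := by
  induction k with
  | zero => rfl
  | succ k ih => rw [pow_succ', Equiv.Perm.mul_apply, ih, pow_succ', Equiv.Perm.mul_apply]; rfl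

theorem val_finRotate {n : ℕ} (i : Fin n) : (finRotate n i).val = (i.val + 1) % n := by
  obtain ⟨m, rfl⟩ : ∃ m, n = m + 1 := ⟨n - 1, by have := i.2; omega⟩
  rw [finRotate_apply, Fin.val_add]
  simp

theorem val_finRotate_pow {n : ℕ} (k : ℕ) (i : Fin n) :
    ((finRotate n ^ k) i).val = (i.val + k) % n := by
  induction k with
  | zero => simp [Nat.mod_eq_of_lt i.2]
  | succ k ih =>
    rw [pow_succ', Equiv.Perm.mul_apply, val_finRotate, ih, Nat.mod_add_mod]
    rfl

theorem cutPos_rot_pow_inl {u : Fin p} {v : Fin q} {k : ℕ} (hk : k < p) :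
    cutPos u v ((rot p q ^ k) (.inl u)) = k := by
  rw [rot_pow_inl, cutPos, val_finRotate_pow, Nat.mod_add_mod]
  have := u.2
  rw [show u.val + k + (p - u.val) = k + p by omega, Nat.add_mod_right, Nat.mod_eq_of_lt hk]

theorem cutPos_rot_pow_inr {u : Fin p} {v : Fin q} {k : ℕ} (hk : k < q) :
    cutPos u v ((rot p q ^ k) (.inr v)) = p + k := by
  rw [rot_pow_inr, cutPos, val_finRotate_pow, Nat.mod_add_mod]
  have := v.2
  rw [show v.val + k + (q - v.val) = k + q by omega, Nat.add_mod_right, Nat.mod_eq_of_lt hk]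

theorem exists_finRotate_pow {n : ℕ} (a b : Fin n) : ∃ k < n, (finRotate n ^ k) a = b := by
  have ha := a.2
  refine ⟨(b.val + (n - a.val)) % n, Nat.mod_lt _ (by omega), Fin.ext ?_⟩
  rw [val_finRotate_pow, Nat.add_mod_mod, show a.val + (b.val + (n - a.val)) = b.val + n by omega,
    Nat.add_mod_right, Nat.mod_eq_of_lt b.2]

/-- The `j + 1`-st point after `x` on its circle. -/
def after (x : Fin p ⊕ Fin q) (j : ℕ) : Fin p ⊕ Fin q := (rot p q ^ (j + 1)) x

theorem rot_after (x : Fin p ⊕ Fin q) (j : ℕ) : rot p q (after x j) = after x (j + 1) := by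
  rw [after, after, pow_succ' _ (j + 1), Equiv.Perm.mul_apply]

theorem after_zero (x : Fin p ⊕ Fin q) : after x 0 = rot p q x := by simp [after]

theorem after_inl (u : Fin p) : after (.inl u : Fin p ⊕ Fin q) (p - 1) = .inl u := by
  have := u.2
  rw [after, rot_pow_inl]
  refine congrArg Sum.inl (Fin.ext ?_)
  rw [val_finRotate_pow, show u.val + (p - 1 + 1) = u.val + p by omega, Nat.add_mod_right,
    Nat.mod_eq_of_lt u.2]

theorem after_inr (v : Fin q) : after (.inr v : Fin p ⊕ Fin q) (q - 1) = .inr v := by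
  have := v.2
  rw [after, rot_pow_inr]
  refine congrArg Sum.inr (Fin.ext ?_)
  rw [val_finRotate_pow, show v.val + (q - 1 + 1) = v.val + q by omega, Nat.add_mod_right,
    Nat.mod_eq_of_lt v.2]

/-- The boundary word of the disc obtained by cutting the annulus along the spoke `{u, v}`. -/
def cutWord (u : Fin p) (v : Fin q) : List (Fin p ⊕ Fin q) :=
  (List.range (p - 1)).map (after (.inl u)) ++ (List.range (q - 1)).map (after (.inr v))

theorem length_cutWord (u : Fin p) (v : Fin q) : (cutWord u v).length + 2 = p + q := by
  have := u.2
  have := v.2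
  simp only [cutWord, List.length_append, List.length_map, List.length_range]
  omega

theorem pairwise_cutWord (u : Fin p) (v : Fin q) :
    (cutWord u v).Pairwise fun x y => cutPos u v x < cutPos u v y := by
  -- The shift by one is due to the ends of the spoke, which occupy the positions `0` and `p`.
  have h1 : ∀ j < p - 1, cutPos u v (after (.inl u) j) = j + 1 := fun j hj =>
    cutPos_rot_pow_inl (by omega)
  have h2 : ∀ j < q - 1, cutPos u v (after (.inr v) j) = p + (j + 1) := fun j hj =>
    cutPos_rot_pow_inr (by omega)
  refine List.pairwise_append.2 ⟨List.pairwise_map.2 ?_, List.pairwise_map.2 ?_, ?_⟩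
  · refine List.pairwise_lt_range.imp_of_mem fun {a b} ha hb hab => ?_
    rw [h1 a (List.mem_range.1 ha), h1 b (List.mem_range.1 hb)]
    omega
  · refine List.pairwise_lt_range.imp_of_mem fun {a b} ha hb hab => ?_
    rw [h2 a (List.mem_range.1 ha), h2 b (List.mem_range.1 hb)]
    omega
  · intro x hx y hy
    obtain ⟨a, ha, rfl⟩ := List.mem_map.1 hx
    obtain ⟨b, hb, rfl⟩ := List.mem_map.1 hy
    have := List.mem_range.1 ha
    rw [h1 a (List.mem_range.1 ha), h2 b (List.mem_range.1 hb)]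
    omega

theorem nodup_cutWord (u : Fin p) (v : Fin q) : (cutWord u v).Nodup :=
  (pairwise_cutWord u v).imp fun h => by rintro rfl; exact lt_irrefl _ h

theorem mem_cutWord {u : Fin p} {v : Fin q} {x : Fin p ⊕ Fin q} :
    x ∈ cutWord u v ↔ x ≠ .inl u ∧ x ≠ .inr v := by
  constructor
  · have hu := cutPos_rot_pow_inl (u := u) (v := v) (k := 0) (by have := u.2; omega)
    have hv := cutPos_rot_pow_inr (u := u) (v := v) (k := 0) (by have := v.2; omega)
    simp only [pow_zero, Equiv.Perm.one_apply] at hu hv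
    intro hx
    have : cutPos u v x ≠ 0 ∧ cutPos u v x ≠ p + 0 := by
      rcases List.mem_append.1 hx with hx | hx
      · obtain ⟨j, hj, rfl⟩ := List.mem_map.1 hx
        have := List.mem_range.1 hj
        rw [after, cutPos_rot_pow_inl (by omega)]
        omega
      · obtain ⟨j, hj, rfl⟩ := List.mem_map.1 hx
        have := List.mem_range.1 hj
        rw [after, cutPos_rot_pow_inr (by omega)]
        omega
    exact ⟨by rintro rfl; exact this.1 hu, by rintro rfl; exact this.2 hv⟩
  · rintro ⟨h1, h2⟩
    rcases x with i | j
    · obtain ⟨k, hk, rfl⟩ := exists_finRotate_pow u i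
      have hk0 : k ≠ 0 := by rintro rfl; exact h1 rfl
      refine List.mem_append_left _ (List.mem_map.2 ⟨k - 1, List.mem_range.2 (by omega), ?_⟩)
      rw [after, rot_pow_inl, show k - 1 + 1 = k by omega]
    · obtain ⟨k, hk, rfl⟩ := exists_finRotate_pow v j
      have hk0 : k ≠ 0 := by rintro rfl; exact h2 rfl
      refine List.mem_append_right _ (List.mem_map.2 ⟨k - 1, List.mem_range.2 (by omega), ?_⟩)
      rw [after, rot_pow_inr, show k - 1 + 1 = k by omega]

variable {π : Equiv.Perm (Fin p ⊕ Fin q)} {u : Fin p} {v : Fin q}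

theorem pairsWord_cutWord (hπ : IsPairPartition π) (huv : π (.inl u) = .inr v) :
    PairsWord π (cutWord u v) := by
  have hvu : π (.inr v) = .inl u := by rw [← huv]; exact (hπ _).1
  intro x hx
  rw [mem_cutWord] at hx ⊢
  refine ⟨⟨fun h => hx.2 (π.injective (h.trans hvu.symm)),
    fun h => hx.1 (π.injective (h.trans huv.symm))⟩, (hπ x).2, (hπ x).1⟩

theorem orderNonCrossing_cutWord :
    OrderNonCrossing (cutPos u v) π (cutWord u v) ↔ NonCrossingOffSpoke π u v := by
  simp only [OrderNonCrossing, NonCrossingOffSpoke, mem_cutWord]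
  exact ⟨fun h a b h1 h2 h3 h4 => h a ⟨h1, h2⟩ b ⟨h3, h4⟩,
    fun h a ha b hb => h a b ha.1 ha.2 hb.1 hb.2⟩

/-- The untwisted spoke identifies the end of each arc with the start of the other, so the cut word
is a closed walk through all vertices. Its length is `p + q - 2`, and the hypothesis is exactly the
bound required by `Walk.reducible`. -/
theorem planar_of_le_numVertices {tw : Fin p ⊕ Fin q → Prop} (hπ : IsPairPartition π)
    (huv : π (.inl u) = .inr v) (htw : ∀ x, tw (π x) ↔ tw x) (hu : ¬ tw (.inl u))
    (hle : p + q ≤ 2 * numVertices (rot p q) π tw) :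
    2 * numVertices (rot p q) π tw = p + q ∧ (∀ x, ¬ tw x) ∧ NonCrossingOffSpoke π u v := by
  classical
  let K := Quot (GlueRel (rot p q) π tw)
  have hfin : Finite K := Finite.of_surjective _ Quot.mk_surjective
  have : Fintype K := Fintype.ofFinite K
  let i : Fin p ⊕ Fin q → K := Quot.mk _
  have hi : Coloring (rot p q) π tw i := coloring_mk _ _ _
  obtain ⟨hs, he⟩ := (hi (.inl u)).2 hu
  rw [huv] at hs he
  beta_reduce at hs he
  have hW1 := walk_map_range (s := i) (e := fun y => i (rot p q y)) (after (.inl u)) (p - 1)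
    (fun j _ => by rw [rot_after])
  have hW2 := walk_map_range (s := i) (e := fun y => i (rot p q y)) (after (.inr v)) (q - 1)
    (fun j _ => by rw [rot_after])
  rw [after_inl, after_zero, he, hs] at hW1
  rw [after_inr, after_zero] at hW2
  have hW : Walk i (fun y => i (rot p q y)) (i (.inr v)) (cutWord u v) (i (.inr v)) :=
    walk_append.2 ⟨_, hW1, hW2⟩
  have huniv : vertexSet i (i (.inr v)) (cutWord u v) = Finset.univ := by
    refine Finset.eq_univ_of_forall fun κ => ?_
    have hL : ∀ x ∈ cutWord u v, i x ∈ vertexSet i (i (.inr v)) (cutWord u v) := fun x hx => by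
      simp only [vertexSet, Finset.mem_insert, List.mem_toFinset, List.mem_map]
      exact Or.inr ⟨x, hx, rfl⟩
    obtain ⟨x, rfl⟩ := Quot.mk_surjective κ
    change i x ∈ _
    by_cases h1 : x = .inl u
    · rw [h1, hs]
      rcases hW2.start_mem with h | ⟨y, hy, h⟩
      · rw [h]; exact Finset.mem_insert_self _ _
      · rw [← h]; exact hL y (List.mem_append_right _ hy)
    by_cases h2 : x = .inr v
    · rw [h2]; exact Finset.mem_insert_self _ _
    exact hL x (mem_cutWord.2 ⟨h1, h2⟩)
  have hcard : (vertexSet i (i (.inr v)) (cutWord u v)).card = numVertices (rot p q) π tw := by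
    rw [huniv, Finset.card_univ, numVertices, Nat.card_eq_fintype_card]
  have hlen := length_cutWord u v
  obtain ⟨h1, h2, h3⟩ := hW.reducible (nodup_cutWord u v) (pairsWord_cutWord hπ huv)
    (fun x _ => htw x) (fun x _ => hi x) (by omega)
  refine ⟨by omega, fun x => ?_, orderNonCrossing_cutWord.1
    (h3.orderNonCrossing (pairsWord_cutWord hπ huv) (pairwise_cutWord u v))⟩
  by_cases hx1 : x = .inl u
  · rwa [hx1]
  by_cases hx2 : x = .inr v
  · rwa [hx2, ← huv, htw]
  exact h2 x (mem_cutWord.2 ⟨hx1, hx2⟩)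

theorem le_numVertices_of_planar (hπ : IsPairPartition π) (huv : π (.inl u) = .inr v)
    (h : NonCrossingOffSpoke π u v) :
    p + q ≤ 2 * numVertices (rot p q) π fun _ => False := by
  have hvu : π (.inr v) = .inl u := by rw [← huv]; exact (hπ _).1
  have hP := pairsWord_cutWord hπ huv
  obtain ⟨s, e, k, hW, hG, hc⟩ := ((orderNonCrossing_cutWord.2 h).reducible hP
    (pairwise_cutWord u v)).exists_walk (nodup_cutWord u v) hP
  obtain ⟨m, hW1, hW2⟩ := walk_append.1 hW
  -- The ends of the spoke close the two arcs: `u` follows the inner arc, which ends at `m`, and `v`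
  -- follows the outer one, which ends at `k`.
  let i : Fin p ⊕ Fin q → ℕ := Function.update (Function.update s (.inl u) m) (.inr v) k
  have hiL : ∀ x ∈ cutWord u v, i x = s x := fun x hx => by
    obtain ⟨h1, h2⟩ := mem_cutWord.1 hx
    simp [i, h1, h2]
  have hiu : i (.inl u) = m := by simp [i]
  have hiv : i (.inr v) = k := by simp [i]
  obtain ⟨h1, h2⟩ := hW1.eq_of_map_range (i := i)
    (fun j hj => hiL _ (List.mem_append_left _ (List.mem_map_of_mem (List.mem_range.2 hj))))
    (by rw [after_inl, hiu])
  obtain ⟨h3, h4⟩ := hW2.eq_of_map_range (i := i)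
    (fun j hj => hiL _ (List.mem_append_right _ (List.mem_map_of_mem (List.mem_range.2 hj))))
    (by rw [after_inr, hiv])
  rw [after_zero] at h1 h3
  have heL : ∀ x ∈ cutWord u v, i (rot p q x) = e x := by
    intro x hx
    rcases List.mem_append.1 hx with hx | hx
    · obtain ⟨j, hj, rfl⟩ := List.mem_map.1 hx
      rw [rot_after, h2 j (List.mem_range.1 hj)]
    · obtain ⟨j, hj, rfl⟩ := List.mem_map.1 hx
      rw [rot_after, h4 j (List.mem_range.1 hj)]
  have hcol : Coloring (rot p q) π (fun _ => False) i := by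
    refine fun x => ⟨fun h => h.elim, fun _ => ?_⟩
    beta_reduce
    by_cases hx1 : x = .inl u
    · rw [hx1, huv, hiu, hiv, h1, h3]; exact ⟨rfl, rfl⟩
    by_cases hx2 : x = .inr v
    · rw [hx2, hvu, hiu, hiv, h1, h3]; exact ⟨rfl, rfl⟩
    have hx := mem_cutWord.2 ⟨hx1, hx2⟩
    rw [hiL x hx, heL x hx, hiL _ (hP x hx).1, heL _ (hP x hx).1]
    exact hG x hx
  have := card_le_numVertices hcol (vertexSet s k (cutWord u v)) (by
    intro κ hκ
    simp only [vertexSet, Finset.mem_insert, List.mem_toFinset, List.mem_map] at hκ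
    rcases hκ with rfl | ⟨x, hx, rfl⟩
    · exact ⟨_, hiv⟩
    · exact ⟨x, hiL x hx⟩)
  have := length_cutWord u v
  omega

end Annulus

/-! ### Reflection of the outer circle -/

section Reflection

variable {p q : ℕ}

/-- The reflection of the outer circle. -/
def reflect (p q : ℕ) : Equiv.Perm (Fin p ⊕ Fin q) := Equiv.sumCongr (Equiv.refl _) Fin.revPerm

theorem reflect_inl (a : Fin p) : reflect p q (.inl a) = .inl a := rfl

theorem reflect_inr (b : Fin q) : reflect p q (.inr b) = .inr b.rev := rfl

theorem reflect_reflect (x : Fin p ⊕ Fin q) : reflect p q (reflect p q x) = x := by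
  rcases x with a | b
  · rfl
  · rw [reflect_inr, reflect_inr, Fin.rev_rev]

theorem isLeft_reflect (x : Fin p ⊕ Fin q) : (reflect p q x).isLeft = x.isLeft := by
  rcases x with a | b <;> rfl

/-- The pair partition `π` after reflection of the outer circle. -/
def reflectPerm (π : Equiv.Perm (Fin p ⊕ Fin q)) : Equiv.Perm (Fin p ⊕ Fin q) :=
  reflect p q * π * reflect p q

theorem reflectPerm_apply (π : Equiv.Perm (Fin p ⊕ Fin q)) (x : Fin p ⊕ Fin q) :
    reflectPerm π x = reflect p q (π (reflect p q x)) := rfl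

theorem reflectPerm_reflectPerm (π : Equiv.Perm (Fin p ⊕ Fin q)) :
    reflectPerm (reflectPerm π) = π := by
  ext1 x
  simp only [reflectPerm_apply, reflect_reflect]

theorem IsPairPartition.reflectPerm {π : Equiv.Perm (Fin p ⊕ Fin q)} (hπ : IsPairPartition π) :
    IsPairPartition (reflectPerm π) := by
  intro x
  simp only [reflectPerm_apply, reflect_reflect, (hπ _).1, true_and]
  intro h
  apply (hπ (reflect p q x)).2
  rw [← reflect_reflect (π (reflect p q x)), h]

/-- The point `x` belongs to a spoke of `π`. -/
def OnSpoke (π : Equiv.Perm (Fin p ⊕ Fin q)) (x : Fin p ⊕ Fin q) : Prop :=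
  x.isLeft ≠ (π x).isLeft

instance (π : Equiv.Perm (Fin p ⊕ Fin q)) (x : Fin p ⊕ Fin q) : Decidable (OnSpoke π x) := by
  unfold OnSpoke
  infer_instance

theorem onSpoke_reflectPerm (π : Equiv.Perm (Fin p ⊕ Fin q)) (x : Fin p ⊕ Fin q) :
    OnSpoke (reflectPerm π) x ↔ OnSpoke π (reflect p q x) := by
  rw [OnSpoke, OnSpoke, reflectPerm_apply, isLeft_reflect, isLeft_reflect]

/-- The twists after reflection of the outer circle. -/
def reflectTwist (π : Equiv.Perm (Fin p ⊕ Fin q)) (tw : Fin p ⊕ Fin q → Prop)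
    (x : Fin p ⊕ Fin q) : Prop :=
  ¬ (tw (reflect p q x) ↔ OnSpoke π (reflect p q x))

theorem reflectTwist_reflectTwist (π : Equiv.Perm (Fin p ⊕ Fin q)) (tw : Fin p ⊕ Fin q → Prop) :
    reflectTwist (reflectPerm π) (reflectTwist π tw) = tw := by
  ext x
  simp only [reflectTwist, onSpoke_reflectPerm, reflect_reflect]
  tauto

/-- The starting index of a letter after reflection of the outer circle. -/
def reflectIndex (p q : ℕ) : Fin p ⊕ Fin q → Fin p ⊕ Fin q
  | .inl a => .inl a
  | .inr b => .inr (finRotate q b.rev)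

theorem finRotate_rev_finRotate_rev {n : ℕ} (b : Fin n) :
    finRotate n (finRotate n b.rev).rev = b := by
  have hb := b.2
  apply Fin.ext
  rw [val_finRotate, Fin.val_rev, val_finRotate, Fin.val_rev]
  rcases Nat.eq_zero_or_pos b.val with h | h
  · rw [show n - (b.val + 1) + 1 = n by omega, Nat.mod_self, show n - (0 + 1) + 1 = n by omega,
      Nat.mod_self, h]
  · rw [Nat.mod_eq_of_lt (show n - (b.val + 1) + 1 < n by omega), Nat.mod_eq_of_lt (by omega)]
    omega

theorem reflectIndex_reflectIndex (x : Fin p ⊕ Fin q) :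
    reflectIndex p q (reflectIndex p q x) = x := by
  rcases x with a | b
  · rfl
  · exact congrArg Sum.inr (finRotate_rev_finRotate_rev b)

theorem reflectIndex_left {y : Fin p ⊕ Fin q} (hy : y.isLeft = true) :
    reflectIndex p q (reflect p q y) = y ∧
      reflectIndex p q (rot p q (reflect p q y)) = rot p q y := by
  rcases y with a | b
  · exact ⟨rfl, rfl⟩
  · simp at hy

theorem reflectIndex_right {y : Fin p ⊕ Fin q} (hy : y.isLeft = false) :
    reflectIndex p q (reflect p q y) = rot p q y ∧
      reflectIndex p q (rot p q (reflect p q y)) = y := by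
  rcases y with a | b
  · simp at hy
  · refine ⟨?_, congrArg Sum.inr (finRotate_rev_finRotate_rev b)⟩
    rw [reflect_inr, reflectIndex, Fin.rev_rev]
    rfl

/-- Reflection exchanges start and end of every outer letter and of no inner one. Within a circle
this affects both letters of a pair or neither and preserves the twist; for a spoke it affects one
and reverses the twist. -/
theorem Coloring.reflect {K : Type*} {π : Equiv.Perm (Fin p ⊕ Fin q)}
    {tw : Fin p ⊕ Fin q → Prop} {i : Fin p ⊕ Fin q → K} (h : Coloring (rot p q) π tw i) :
    Coloring (rot p q) (reflectPerm π) (reflectTwist π tw) fun x => i (reflectIndex p q x) := by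
  intro x
  obtain ⟨y, rfl⟩ : ∃ y, x = EllipticCov.reflect p q y := ⟨_, (reflect_reflect x).symm⟩
  have hy := h y
  simp only [Glued, reflectPerm_apply, reflectTwist, reflect_reflect, OnSpoke] at hy ⊢
  cases h1 : y.isLeft <;> cases h2 : (π y).isLeft <;>
    simp only [reflectIndex_left, reflectIndex_right, h1, h2, ne_eq, not_true_eq_false, iff_false,
      not_not, Bool.true_eq_false, Bool.false_eq_true, not_false_eq_true, iff_true] <;>
    tauto

theorem numVertices_le_reflect (π : Equiv.Perm (Fin p ⊕ Fin q)) (tw : Fin p ⊕ Fin q → Prop) :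
    numVertices (rot p q) π tw ≤
      numVertices (rot p q) (reflectPerm π) (reflectTwist π tw) := by
  have h := Nat.card_le_card_of_injective
    (fun i : {i : Fin p ⊕ Fin q → Fin 2 // Coloring (rot p q) π tw i} =>
      (⟨fun x => i.1 (reflectIndex p q x), i.2.reflect⟩ : {i : Fin p ⊕ Fin q → Fin 2 //
        Coloring (rot p q) (reflectPerm π) (reflectTwist π tw) i})) (by
      intro i j hij
      refine Subtype.ext (funext fun x => ?_)
      have := congrFun (congrArg Subtype.val hij) (reflectIndex p q x)
      simpa only [reflectIndex_reflectIndex] using this)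
  rw [card_coloring, card_coloring, Nat.card_eq_fintype_card, Fintype.card_fin] at h
  -- Two colours suffice to compare the numbers of vertices, which are exponents of 2 here.
  exact (Nat.pow_le_pow_iff_right (by norm_num)).1 h

theorem numVertices_reflect (π : Equiv.Perm (Fin p ⊕ Fin q)) (tw : Fin p ⊕ Fin q → Prop) :
    numVertices (rot p q) (reflectPerm π) (reflectTwist π tw) =
      numVertices (rot p q) π tw := by
  refine le_antisymm ?_ (numVertices_le_reflect π tw)
  have := numVertices_le_reflect (reflectPerm π) (reflectTwist π tw)
  rwa [reflectPerm_reflectPerm, reflectTwist_reflectTwist] at this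

theorem mem_NC2 {π : Equiv.Perm (Fin p ⊕ Fin q)} : π ∈ NC2 p q ↔ IsAnnularNonCrossing π := by
  simp [NC2]

theorem exists_spoke {π : Equiv.Perm (Fin p ⊕ Fin q)} (hπ : IsPairPartition π)
    (h : ∃ x, OnSpoke π x) : ∃ u v, π (.inl u) = .inr v := by
  obtain ⟨x, hx⟩ := h
  rcases x with a | b
  · rcases hy : π (.inl a) with c | d
    · simp [OnSpoke, hy] at hx
    · exact ⟨a, d, hy⟩
  · rcases hy : π (.inr b) with c | d
    · exact ⟨c, b, by rw [← hy]; exact (hπ _).1⟩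
    · simp [OnSpoke, hy] at hx

theorem onSpoke_apply {π : Equiv.Perm (Fin p ⊕ Fin q)} (hπ : IsPairPartition π)
    (x : Fin p ⊕ Fin q) : OnSpoke π (π x) ↔ OnSpoke π x := by
  rw [OnSpoke, OnSpoke, (hπ x).1, ne_comm]

theorem reflectTwist_apply {π : Equiv.Perm (Fin p ⊕ Fin q)} (hπ : IsPairPartition π)
    {tw : Fin p ⊕ Fin q → Prop} (htw : ∀ x, tw (π x) ↔ tw x) (x : Fin p ⊕ Fin q) :
    reflectTwist π tw (reflectPerm π x) ↔ reflectTwist π tw x := by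
  rw [reflectTwist, reflectTwist, reflectPerm_apply, reflect_reflect, htw, onSpoke_apply hπ]

/-- An untwisted spoke allows cutting at once; a twisted one becomes untwisted after reflection. In
the second case, absence of twists after reflection means that exactly the spokes were twisted. -/
theorem two_mul_numVertices_of_le {π : Equiv.Perm (Fin p ⊕ Fin q)} (hπ : IsPairPartition π)
    (hsp : ∃ x, OnSpoke π x) {tw : Fin p ⊕ Fin q → Prop} (htw : ∀ x, tw (π x) ↔ tw x)
    (hle : p + q ≤ 2 * numVertices (rot p q) π tw) :
    2 * numVertices (rot p q) π tw = p + q ∧ ((∀ x, ¬ tw x) ∧ π ∈ NC2 p q ∨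
      (∀ x, tw x ↔ OnSpoke π x) ∧ reflectPerm π ∈ NC2 p q) := by
  obtain ⟨u, v, huv⟩ := exists_spoke hπ hsp
  by_cases hu : tw (.inl u)
  · have huv' : reflectPerm π (.inl u) = .inr v.rev := by
      rw [reflectPerm_apply, reflect_inl, huv, reflect_inr]
    rw [← numVertices_reflect] at hle ⊢
    obtain ⟨h1, h2, h3⟩ := planar_of_le_numVertices hπ.reflectPerm huv'
      (reflectTwist_apply hπ htw) (by
        simp only [reflectTwist, reflect_inl, hu, OnSpoke, huv]
        simp) hle
    refine ⟨h1, Or.inr ⟨fun x => ?_, mem_NC2.2 ⟨hπ.reflectPerm, u, v.rev, huv', h3⟩⟩⟩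
    have := h2 (reflect p q x)
    rwa [reflectTwist, reflect_reflect, not_not] at this
  · obtain ⟨h1, h2, h3⟩ := planar_of_le_numVertices hπ huv htw hu hle
    exact ⟨h1, Or.inl ⟨h2, mem_NC2.2 ⟨hπ, u, v, huv, h3⟩⟩⟩

theorem two_mul_numVertices_le {π : Equiv.Perm (Fin p ⊕ Fin q)} (hπ : IsPairPartition π)
    (hsp : ∃ x, OnSpoke π x) {tw : Fin p ⊕ Fin q → Prop} (htw : ∀ x, tw (π x) ↔ tw x) :
    2 * numVertices (rot p q) π tw ≤ p + q := by
  by_contra h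
  have := (two_mul_numVertices_of_le hπ hsp htw (by omega)).1
  omega

theorem le_numVertices_of_mem_NC2 {π : Equiv.Perm (Fin p ⊕ Fin q)} (h : π ∈ NC2 p q)
    {tw : Fin p ⊕ Fin q → Prop} (htw : ∀ x, ¬ tw x) :
    p + q ≤ 2 * numVertices (rot p q) π tw := by
  obtain ⟨hπ, u, v, huv, hnc⟩ := mem_NC2.1 h
  have : tw = fun _ => False := by ext x; simp [htw x]
  rw [this]
  exact le_numVertices_of_planar hπ huv hnc

/-- The gluings of maximal Euler characteristic: all pairs are untwisted and the partition is
annular non-crossing, or exactly the spokes are twisted and the partition is annular non-crossing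
after reflection of the outer circle. -/
theorem two_mul_numVertices_eq_iff {π : Equiv.Perm (Fin p ⊕ Fin q)} (hπ : IsPairPartition π)
    (hsp : ∃ x, OnSpoke π x) {tw : Fin p ⊕ Fin q → Prop} (htw : ∀ x, tw (π x) ↔ tw x) :
    2 * numVertices (rot p q) π tw = p + q ↔ ((∀ x, ¬ tw x) ∧ π ∈ NC2 p q ∨
      (∀ x, tw x ↔ OnSpoke π x) ∧ reflectPerm π ∈ NC2 p q) := by
  refine ⟨fun h => (two_mul_numVertices_of_le hπ hsp htw h.ge).2, fun h => ?_⟩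
  refine le_antisymm (two_mul_numVertices_le hπ hsp htw) ?_
  rcases h with ⟨h1, h2⟩ | ⟨h1, h2⟩
  · exact le_numVertices_of_mem_NC2 h2 h1
  · rw [← numVertices_reflect]
    exact le_numVertices_of_mem_NC2 h2 fun x => by simp [reflectTwist, h1]

end Reflection

/-! ### The statistics of a pair partition as products over its pairs -/

section Statistics

variable {p q : ℕ}

theorem card_filter_pairs {key : Fin p ⊕ Fin q → ℕ} (hkey : Function.Injective key)
    {π : Equiv.Perm (Fin p ⊕ Fin q)} (hπ : IsPairPartition π)
    (Q : Finset (Fin p ⊕ Fin q) → Prop) [DecidablePred Q] :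
    ((pairs π).filter Q).card = ((firsts key π).filter fun x => Q {x, π x}).card := by
  symm
  refine Finset.card_bij (fun x _ => {x, π x}) ?_ ?_ ?_
  · intro x hx
    rw [Finset.mem_filter] at hx ⊢
    exact ⟨Finset.mem_image_of_mem _ (Finset.mem_univ x), hx.2⟩
  · intro x hx y hy hxy
    have hx' := mem_firsts.1 (Finset.mem_filter.1 hx).1
    have hy' := mem_firsts.1 (Finset.mem_filter.1 hy).1
    have h : x ∈ ({y, π y} : Finset (Fin p ⊕ Fin q)) := by rw [← hxy]; simp
    rcases Finset.mem_insert.1 h with h | h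
    · exact h
    · rw [Finset.mem_singleton.1 h, (hπ y).1] at hx'
      omega
  · intro B hB
    rw [Finset.mem_filter, pairs, Finset.mem_image] at hB
    obtain ⟨⟨x, -, rfl⟩, hQ⟩ := hB
    have hne : key x ≠ key (π x) := fun h => (hπ x).2 (hkey h).symm
    rcases lt_or_gt_of_ne hne with h | h
    · exact ⟨x, Finset.mem_filter.2 ⟨mem_firsts.2 h, hQ⟩, rfl⟩
    · have e : ({π x, π (π x)} : Finset (Fin p ⊕ Fin q)) = {x, π x} := by
        rw [(hπ x).1, Finset.pair_comm]
      refine ⟨π x, Finset.mem_filter.2 ⟨mem_firsts.2 ?_, ?_⟩, e⟩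
      · rwa [(hπ x).1]
      · rwa [e]

theorem sameType_pair {τ : Fin p ⊕ Fin q → Letter} {x y : Fin p ⊕ Fin q} :
    SameType τ {x, y} ↔ τ x = τ y := by
  simp only [SameType, Finset.mem_insert, Finset.mem_singleton, forall_eq_or_imp, forall_eq]
  exact ⟨fun h => h.1.2, fun h => ⟨⟨trivial, h⟩, h.symm, trivial⟩⟩

theorem isSpoke_pair {π : Equiv.Perm (Fin p ⊕ Fin q)} {x : Fin p ⊕ Fin q} :
    IsSpoke {x, π x} ↔ OnSpoke π x := by
  rw [OnSpoke]
  generalize π x = y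
  rcases x with a | a <;> rcases y with b | b <;> simp [IsSpoke]

variable {key : Fin p ⊕ Fin q → ℕ} {π : Equiv.Perm (Fin p ⊕ Fin q)}

theorem pow_numSame (hkey : Function.Injective key) (hπ : IsPairPartition π)
    (τ : Fin p ⊕ Fin q → Letter) (γ : ℝ) :
    γ ^ numSame π τ = ∏ x ∈ firsts key π, if τ x = τ (π x) then γ else 1 := by
  rw [Finset.prod_ite, Finset.prod_const, Finset.prod_const_one, mul_one, numSame,
    card_filter_pairs hkey hπ]
  simp only [sameType_pair]

/-- A pair contributes γ exactly if it is a spoke or of the same type but not both; the exponent is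
the size of this symmetric difference. -/
theorem pow_numSame_add_numSpokes_sub (hkey : Function.Injective key) (hπ : IsPairPartition π)
    (τ : Fin p ⊕ Fin q → Letter) (γ : ℝ) :
    γ ^ (numSame π τ + numSpokes π - 2 * numSameSpokes π τ) =
      ∏ x ∈ firsts key π, if OnSpoke π x then (if τ x = τ (π x) then 1 else γ)
        else (if τ x = τ (π x) then γ else 1) := by
  have h1 : ∀ x, (if OnSpoke π x then (if τ x = τ (π x) then 1 else γ)
        else (if τ x = τ (π x) then γ else 1)) =
      if ¬ (OnSpoke π x ↔ τ x = τ (π x)) then γ else 1 := fun x => by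
    by_cases h1 : OnSpoke π x <;> by_cases h2 : τ x = τ (π x) <;> simp [h1, h2]
  simp only [h1]
  rw [Finset.prod_ite, Finset.prod_const, Finset.prod_const_one, mul_one, numSame, numSpokes,
    numSameSpokes, card_filter_pairs hkey hπ, card_filter_pairs hkey hπ, card_filter_pairs hkey hπ]
  simp only [sameType_pair, isSpoke_pair]
  congr 1
  have h2 := Finset.card_filter_add_card_filter_not (s := (firsts key π).filter fun x => OnSpoke π x)
    (fun x => τ x = τ (π x))
  have h3 := Finset.card_filter_add_card_filter_not
    (s := (firsts key π).filter fun x => τ x = τ (π x)) (fun x => OnSpoke π x)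
  have h4 := Finset.card_filter_add_card_filter_not
    (s := (firsts key π).filter fun x => ¬ (OnSpoke π x ↔ τ x = τ (π x))) (fun x => OnSpoke π x)
  simp only [Finset.filter_filter] at h2 h3 h4
  have e1 : (firsts key π).filter (fun x => τ x = τ (π x) ∧ OnSpoke π x) =
      (firsts key π).filter fun x => OnSpoke π x ∧ τ x = τ (π x) :=
    Finset.filter_congr fun x _ => and_comm
  have e2 : (firsts key π).filter (fun x => ¬ (OnSpoke π x ↔ τ x = τ (π x)) ∧ OnSpoke π x) =
      (firsts key π).filter fun x => OnSpoke π x ∧ ¬ τ x = τ (π x) :=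
    Finset.filter_congr fun x _ => by tauto
  have e3 : (firsts key π).filter (fun x => ¬ (OnSpoke π x ↔ τ x = τ (π x)) ∧ ¬ OnSpoke π x) =
      (firsts key π).filter fun x => τ x = τ (π x) ∧ ¬ OnSpoke π x :=
    Finset.filter_congr fun x _ => by tauto
  rw [e1] at h3
  rw [e2, e3] at h4
  omega

theorem reverseOuter_eq (τ : Fin p ⊕ Fin q → Letter) (x : Fin p ⊕ Fin q) :
    reverseOuter τ x = τ (reflect p q x) := by
  rcases x with a | b <;> rfl

theorem pow_reflectPerm (hkey : Function.Injective key) (hπ : IsPairPartition π)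
    (τ : Fin p ⊕ Fin q → Letter) (γ : ℝ) :
    γ ^ (numSame (reflectPerm π) (reverseOuter τ) + numSpokes (reflectPerm π) -
        2 * numSameSpokes (reflectPerm π) (reverseOuter τ)) =
      ∏ x ∈ firsts key π, if OnSpoke π x then (if τ x = τ (π x) then 1 else γ)
        else (if τ x = τ (π x) then γ else 1) := by
  -- The numbering is transported by the reflection, so that first points correspond to first
  -- points.
  rw [pow_numSame_add_numSpokes_sub (key := fun x => key (reflect p q x))
    (hkey.comp (reflect p q).injective) hπ.reflectPerm]
  refine Finset.prod_equiv (reflect p q) (fun x => ?_) (fun x _ => ?_)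
  · rw [mem_firsts, mem_firsts, reflectPerm_apply, reflect_reflect]
  · simp only [onSpoke_reflectPerm, reverseOuter_eq, reflectPerm_apply, reflect_reflect]

end Statistics

/-! ### The covariance as a sum over gluings -/

section Expansion

theorem entryCov_entry {N : ℕ} (γ : ℝ) (l l' : Letter) (a b c d : Fin N) :
    entryCov γ (l.entry a b) (l'.entry c d) =
      (if l = l' then 1 else γ) * (if a = c ∧ b = d then 1 else 0) +
        (if l = l' then γ else 1) * (if a = d ∧ b = c then 1 else 0) := by
  have h : ∀ a b c d : Fin N, entryCov γ (a, b) (c, d) = (if a = c ∧ b = d then 1 else 0) +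
      γ * (if a = d ∧ b = c then 1 else 0) := fun _ _ _ _ => rfl
  cases l <;> cases l' <;>
    simp only [h, Letter.entry, reduceCtorEq, if_true, if_false, one_mul,
      @and_comm (b = c) (a = d), @and_comm (b = d) (a = c)] <;>
    ring

/-- If `M` satisfies the recursion of `eq_sum_pairPerms` for `C`, then the product of `M` over the
two classes of points satisfies it for the restriction of `C` to the pairs within a class. -/
theorem recursion_mul_filter {V R : Type*} [DecidableEq V] [CommSemiring R] {C : V → V → R}
    {M : Finset V → R}
    (hM : ∀ S a, a ∉ S → M (insert a S) = ∑ y ∈ S, C a y * M (S.erase y)) (b : V → Bool)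
    (S : Finset V) (a : V) (ha : a ∉ S) :
    M ((insert a S).filter fun x => b x = true) * M ((insert a S).filter fun x => b x = false) =
      ∑ y ∈ S, (if b a = b y then C a y else 0) * (M ((S.erase y).filter fun x => b x = true) *
        M ((S.erase y).filter fun x => b x = false)) := by
  have hcomm : ∀ (t : Bool) (S : Finset V), M (S.filter fun x => b x = true) *
      M (S.filter fun x => b x = false) = M (S.filter fun x => b x = t) *
        M (S.filter fun x => b x = !t) := fun t S => by
    cases t
    · exact mul_comm _ _
    · rfl
  simp only [hcomm (b a)]
  rw [Finset.filter_insert, Finset.filter_insert, if_pos rfl, if_neg (by simp),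
    hM _ _ (by simp [ha]), Finset.sum_mul, Finset.sum_filter]
  refine Finset.sum_congr rfl fun y _ => ?_
  by_cases hy : b a = b y
  · have h1 : (S.erase y).filter (fun x => b x = b a) = (S.filter fun x => b x = b a).erase y := by
      ext x; simp only [Finset.mem_filter, Finset.mem_erase]; tauto
    have h2 : (S.erase y).filter (fun x => b x = !b a) = S.filter fun x => b x = !b a := by
      ext x
      simp only [Finset.mem_filter, Finset.mem_erase]
      refine ⟨fun h => ⟨h.1.2, h.2⟩, fun h => ⟨⟨?_, h.1⟩, h.2⟩⟩
      rintro rfl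
      rw [hy] at h
      simp at h
    rw [if_pos hy.symm, if_pos hy, h1, h2, mul_assoc]
  · rw [if_neg (fun h => hy h.symm), if_neg hy, zero_mul]

variable {p q : ℕ}

/-- The numbering of the points of the two circles. -/
def pointKey (p q : ℕ) : Fin p ⊕ Fin q → ℕ
  | .inl i => i.val
  | .inr j => p + j.val

theorem pointKey_injective : Function.Injective (pointKey p q) := by
  rintro (a | a) (b | b) h <;> simp only [pointKey] at h
  · exact congrArg _ (Fin.ext h)
  · have := a.2; omega
  · have := b.2; omega
  · exact congrArg _ (Fin.ext (by omega))

theorem isPairPartition_iff {π : Equiv.Perm (Fin p ⊕ Fin q)} :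
    IsPairPartition π ↔ π ∈ pairPerms Finset.univ := by
  simp [IsPairPartition, mem_pairPerms, forall_and]

/-- The pair partitions with a spoke. -/
def spokePerms (p q : ℕ) : Finset (Equiv.Perm (Fin p ⊕ Fin q)) :=
  (pairPerms Finset.univ).filter fun π => ∃ x, OnSpoke π x

theorem mem_spokePerms {π : Equiv.Perm (Fin p ⊕ Fin q)} :
    π ∈ spokePerms p q ↔ IsPairPartition π ∧ ∃ x, OnSpoke π x := by
  rw [spokePerms, Finset.mem_filter, isPairPartition_iff]

/-- In the second sum a spoke contributes a factor 0, whereas a partition without spokes has the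
same term in both sums. -/
theorem sum_pairPerms_sub {key : Fin p ⊕ Fin q → ℕ} (hkey : Function.Injective key)
    (C : Fin p ⊕ Fin q → Fin p ⊕ Fin q → ℝ) :
    ∑ π ∈ pairPerms Finset.univ, ∏ x ∈ firsts key π, C x (π x) -
      ∑ π ∈ pairPerms Finset.univ, ∏ x ∈ firsts key π,
        (if x.isLeft = (π x).isLeft then C x (π x) else 0) =
    ∑ π ∈ spokePerms p q, ∏ x ∈ firsts key π, C x (π x) := by
  rw [← Finset.sum_sub_distrib, spokePerms, Finset.sum_filter]
  refine Finset.sum_congr rfl fun π hπ => ?_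
  have hπ' := isPairPartition_iff.2 hπ
  split_ifs with h
  · obtain ⟨x, hx⟩ := h
    rw [sub_eq_self]
    have hne : key x ≠ key (π x) := fun h => (hπ' x).2 (hkey h).symm
    rcases lt_or_gt_of_ne hne with h | h
    · exact Finset.prod_eq_zero (mem_firsts.2 h) (if_neg hx)
    · refine Finset.prod_eq_zero (i := π x) (mem_firsts.2 (by rwa [(hπ' x).1])) (if_neg ?_)
      exact (onSpoke_apply hπ' x).2 hx
  · rw [sub_eq_zero]
    refine Finset.prod_congr rfl fun x _ => (if_pos ?_).symm
    by_contra hx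
    exact h ⟨x, hx⟩

/-- The points whose pair has its first point in `U`. -/
def twistOf (π : Equiv.Perm (Fin p ⊕ Fin q)) (U : Finset (Fin p ⊕ Fin q)) (x : Fin p ⊕ Fin q) :
    Prop :=
  x ∈ U ∨ π x ∈ U

theorem twistOf_apply {π : Equiv.Perm (Fin p ⊕ Fin q)} (hπ : IsPairPartition π)
    (U : Finset (Fin p ⊕ Fin q)) (x : Fin p ⊕ Fin q) : twistOf π U (π x) ↔ twistOf π U x := by
  rw [twistOf, twistOf, (hπ x).1, or_comm]

theorem twistOf_iff_of_mem_firsts {key : Fin p ⊕ Fin q → ℕ} {π : Equiv.Perm (Fin p ⊕ Fin q)}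
    (hπ : IsPairPartition π) {U : Finset (Fin p ⊕ Fin q)} (hU : U ⊆ firsts key π)
    {x : Fin p ⊕ Fin q} (hx : x ∈ firsts key π) : twistOf π U x ↔ x ∈ U := by
  refine ⟨fun h => h.resolve_right fun h => ?_, Or.inl⟩
  have h1 := mem_firsts.1 (hU h)
  have h2 := mem_firsts.1 hx
  rw [(hπ x).1] at h1
  omega

theorem forall_iff_forall_firsts {key : Fin p ⊕ Fin q → ℕ} (hkey : Function.Injective key)
    {π : Equiv.Perm (Fin p ⊕ Fin q)} (hπ : IsPairPartition π) {Q : Fin p ⊕ Fin q → Prop}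
    (hQ : ∀ x, Q (π x) → Q x) : (∀ x, Q x) ↔ ∀ x ∈ firsts key π, Q x := by
  refine ⟨fun h x _ => h x, fun h x => ?_⟩
  have hne : key x ≠ key (π x) := fun h => (hπ x).2 (hkey h).symm
  rcases lt_or_gt_of_ne hne with h' | h'
  · exact h x (mem_firsts.2 h')
  · exact hQ x (h _ (mem_firsts.2 (by rwa [(hπ x).1])))

theorem coloring_twistOf_iff {K : Type*} {key : Fin p ⊕ Fin q → ℕ}
    (hkey : Function.Injective key) {π : Equiv.Perm (Fin p ⊕ Fin q)} (hπ : IsPairPartition π)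
    {U : Finset (Fin p ⊕ Fin q)} (hU : U ⊆ firsts key π) {i : Fin p ⊕ Fin q → K} :
    Coloring (rot p q) π (twistOf π U) i ↔
      (∀ x ∈ U, i x = i (π x) ∧ i (rot p q x) = i (rot p q (π x))) ∧
        ∀ x ∈ firsts key π \ U, i x = i (rot p q (π x)) ∧ i (rot p q x) = i (π x) := by
  rw [Coloring, forall_iff_forall_firsts hkey hπ]
  · constructor
    · refine fun h => ⟨fun x hx => (h x (hU hx)).1 (Or.inl hx), fun x hx => ?_⟩
      obtain ⟨h1, h2⟩ := Finset.mem_sdiff.1 hx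
      exact (h x h1).2 (by rwa [twistOf_iff_of_mem_firsts hπ hU h1])
    · intro h x hx
      rw [Glued, twistOf_iff_of_mem_firsts hπ hU hx]
      exact ⟨fun hxU => h.1 x hxU, fun hxU => h.2 x (Finset.mem_sdiff.2 ⟨hx, hxU⟩)⟩
  · intro x h
    rw [Glued, twistOf_apply hπ, (hπ x).1] at h
    refine ⟨fun ht => ⟨(h.1 ht).1.symm, (h.1 ht).2.symm⟩,
      fun ht => ⟨(h.2 ht).2.symm, (h.2 ht).1.symm⟩⟩

/-- The weight of the gluing along `π` in which the pairs of the points of `U` are twisted. -/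
noncomputable def gluingWeight (γ : ℝ) (τ : Fin p ⊕ Fin q → Letter)
    (π : Equiv.Perm (Fin p ⊕ Fin q)) (U : Finset (Fin p ⊕ Fin q)) : ℝ :=
  (∏ x ∈ U, if τ x = τ (π x) then 1 else γ) *
    ∏ x ∈ firsts (pointKey p q) π \ U, if τ x = τ (π x) then γ else 1

/-- The entry that occurs for the letter `x` if the indices are given by `i`. -/
def letterEntry {N : ℕ} (τ : Fin p ⊕ Fin q → Letter) (i : Fin p ⊕ Fin q → Fin N)
    (x : Fin p ⊕ Fin q) : Fin N × Fin N :=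
  (τ x).entry (i x) (i (rot p q x))

/-- Expanding the product of the two-term covariances amounts to choosing the set `U` of twisted
pairs. The product of the Kronecker terms is then the indicator of the colourings. -/
theorem sum_prod_entryCov {N : ℕ} (γ : ℝ) (τ : Fin p ⊕ Fin q → Letter)
    {π : Equiv.Perm (Fin p ⊕ Fin q)} (hπ : IsPairPartition π) :
    ∑ i : Fin p ⊕ Fin q → Fin N, ∏ x ∈ firsts (pointKey p q) π,
      entryCov γ (letterEntry τ i x) (letterEntry τ i (π x)) =
    ∑ U ∈ (firsts (pointKey p q) π).powerset, gluingWeight γ τ π U *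
      (N : ℝ) ^ numVertices (rot p q) π (twistOf π U) := by
  classical
  simp only [letterEntry, entryCov_entry, Finset.prod_add]
  rw [Finset.sum_comm]
  refine Finset.sum_congr rfl fun U hU => ?_
  have hcard := card_coloring (rot p q) π (twistOf π U) (Fin N)
  rw [Nat.card_eq_fintype_card, Nat.card_eq_fintype_card, Fintype.card_fin,
    Fintype.card_subtype] at hcard
  rw [← Nat.cast_pow, ← hcard, Finset.card_filter, Nat.cast_sum, Finset.mul_sum]
  refine Finset.sum_congr rfl fun i _ => ?_
  rw [Finset.prod_mul_distrib, Finset.prod_mul_distrib, Finset.prod_ite_zero, Finset.prod_ite_zero]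
  simp only [Finset.prod_const_one, gluingWeight,
    coloring_twistOf_iff pointKey_injective hπ (Finset.mem_powerset.1 hU)]
  push_cast
  rw [ite_and]
  split_ifs <;> simp_all

end Expansion

/-! ### Integrability and covariance of the traces -/

section Covariance

variable {Ω : Type*} [MeasurableSpace Ω] {P : Measure Ω} [IsProbabilityMeasure P] {N : ℕ} {γ : ℝ}
  {G : Ω → Matrix (Fin N) (Fin N) ℝ}

theorem IsRealGaussianElliptic.integrable_prod (hG : IsRealGaussianElliptic γ G P) {V : Type*}
    (S : Finset V) (c : V → Fin N × Fin N) :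
    Integrable (fun ω => ∏ x ∈ S, G ω (c x).1 (c x).2) P := by
  refine (integrable_eval_mvPolynomial (fun a => hG.hasGaussianLaw.eval a)
    (∏ x ∈ S, MvPolynomial.X (c x))).congr (Eventually.of_forall fun ω => ?_)
  simp

theorem IsRealGaussianElliptic.memLp_traceWord (hG : IsRealGaussianElliptic γ G P) {n : ℕ}
    (hn : 1 ≤ n) (w : Fin n → Letter) :
    MemLp (fun ω => traceWord w (normalized (G ω))) 2 P := by
  have h := memLp_eval_mvPolynomial (fun a => hG.hasGaussianLaw.eval a)
    (MvPolynomial.C ((1 / √(N : ℝ)) ^ n) * ∑ i : Fin n → Fin N,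
      ∏ t, MvPolynomial.X ((w t).entry (i t) (i (finRotate n t)))) 2
  refine MemLp.ae_eq (Eventually.of_forall fun ω => ?_) h
  simp [traceWord_normalized hn]

theorem IsRealGaussianElliptic.integral_traceWord (hG : IsRealGaussianElliptic γ G P) {n : ℕ}
    (hn : 1 ≤ n) (w : Fin n → Letter) :
    ∫ ω, traceWord w (normalized (G ω)) ∂P = (1 / √(N : ℝ)) ^ n * ∑ i : Fin n → Fin N,
      ∫ ω, ∏ t, G ω ((w t).entry (i t) (i (finRotate n t))).1
        ((w t).entry (i t) (i (finRotate n t))).2 ∂P := by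
  simp only [traceWord_normalized hn, integral_const_mul]
  rw [integral_finsetSum _ fun i _ => hG.integrable_prod _ _]

theorem sum_arrow_sum {p q N : ℕ} (F : (Fin p ⊕ Fin q → Fin N) → ℝ) :
    ∑ i, F i = ∑ a : Fin p → Fin N, ∑ b : Fin q → Fin N, F (Sum.elim a b) := by
  rw [← Fintype.sum_prod_type']
  exact Fintype.sum_equiv (Equiv.sumArrowEquivProdArrow (Fin p) (Fin q) (Fin N)) _ _ fun i => by
    congr 1
    ext x
    rcases x with a | b <;> rfl

theorem IsRealGaussianElliptic.covariance_traceWord (hG : IsRealGaussianElliptic γ G P) {p q : ℕ}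
    (hp : 1 ≤ p) (hq : 1 ≤ q) (τ : Fin p ⊕ Fin q → Letter) :
    cov[fun ω => traceWord (fun t => τ (.inl t)) (normalized (G ω)),
      fun ω => traceWord (fun t => τ (.inr t)) (normalized (G ω)); P] =
    ∑ π ∈ spokePerms p q, ∑ U ∈ (firsts (pointKey p q) π).powerset, gluingWeight γ τ π U *
      ((1 / √(N : ℝ)) ^ (p + q) * (N : ℝ) ^ numVertices (rot p q) π (twistOf π U)) := by
  let M : (Fin p ⊕ Fin q → Fin N) → Finset (Fin p ⊕ Fin q) → ℝ := fun i S =>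
    ∫ ω, ∏ x ∈ S, G ω (letterEntry τ i x).1 (letterEntry τ i x).2 ∂P
  have hM0 : ∀ i, M i ∅ = 1 := fun i => by simp [M]
  have hM : ∀ i S a, a ∉ S → M i (insert a S) =
      ∑ y ∈ S, entryCov γ (letterEntry τ i a) (letterEntry τ i y) * M i (S.erase y) := by
    intro i S a ha
    simp only [M, Finset.prod_insert ha]
    exact hG.integral_mul_prod S _ _
  have hmom : ∀ i, M i Finset.univ = ∑ π ∈ pairPerms Finset.univ,
      ∏ x ∈ firsts (pointKey p q) π, entryCov γ (letterEntry τ i x) (letterEntry τ i (π x)) :=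
    fun i => eq_sum_pairPerms pointKey_injective
      (fun x y => entryCov γ (letterEntry τ i x) (letterEntry τ i y)) (M i) (hM0 i) (hM i) _
  -- The product of the inner and the outer moment obeys the same recursion with the covariances
  -- across the circles set to zero.
  have hmul : ∀ i, M i (Finset.univ.filter fun x => x.isLeft = true) *
      M i (Finset.univ.filter fun x => x.isLeft = false) = ∑ π ∈ pairPerms Finset.univ,
        ∏ x ∈ firsts (pointKey p q) π, (if x.isLeft = (π x).isLeft then
          entryCov γ (letterEntry τ i x) (letterEntry τ i (π x)) else 0) :=
    fun i => eq_sum_pairPerms pointKey_injective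
      (fun x y => if x.isLeft = y.isLeft then
        entryCov γ (letterEntry τ i x) (letterEntry τ i y) else 0)
      (fun S => M i (S.filter fun x => x.isLeft = true) * M i (S.filter fun x => x.isLeft = false))
      (by simp [hM0]) (recursion_mul_filter (hM i) Sum.isLeft) _
  have hleft : ∀ a b, M (Sum.elim a b) (Finset.univ.filter fun x => x.isLeft = true) =
      ∫ ω, ∏ t, G ω ((τ (.inl t)).entry (a t) (a (finRotate p t))).1
        ((τ (.inl t)).entry (a t) (a (finRotate p t))).2 ∂P := fun a b => by
    simp only [M, Finset.prod_filter, Fintype.prod_sum_type]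
    simp [letterEntry, rot]
  have hright : ∀ a b, M (Sum.elim a b) (Finset.univ.filter fun x => x.isLeft = false) =
      ∫ ω, ∏ t, G ω ((τ (.inr t)).entry (b t) (b (finRotate q t))).1
        ((τ (.inr t)).entry (b t) (b (finRotate q t))).2 ∂P := fun a b => by
    simp only [M, Finset.prod_filter, Fintype.prod_sum_type]
    simp [letterEntry, rot]
  have hprod : ∫ ω, traceWord (fun t => τ (.inl t)) (normalized (G ω)) *
      traceWord (fun t => τ (.inr t)) (normalized (G ω)) ∂P =
        (1 / √(N : ℝ)) ^ (p + q) * ∑ i, M i Finset.univ := by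
    rw [← integral_finsetSum _ fun i _ => hG.integrable_prod _ _, ← integral_const_mul]
    congr 1 with ω
    rw [traceWord_normalized hp, traceWord_normalized hq, mul_mul_mul_comm, ← pow_add,
      Finset.sum_mul_sum, sum_arrow_sum]
    simp only [Fintype.prod_sum_type]
    simp [letterEntry, rot]
  have hsplit : (∑ a : Fin p → Fin N, ∫ ω, ∏ t, G ω ((τ (.inl t)).entry (a t) (a (finRotate p t))).1
        ((τ (.inl t)).entry (a t) (a (finRotate p t))).2 ∂P) *
      (∑ b : Fin q → Fin N, ∫ ω, ∏ t, G ω ((τ (.inr t)).entry (b t) (b (finRotate q t))).1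
        ((τ (.inr t)).entry (b t) (b (finRotate q t))).2 ∂P) =
      ∑ i, M i (Finset.univ.filter fun x => x.isLeft = true) *
        M i (Finset.univ.filter fun x => x.isLeft = false) := by
    rw [Finset.sum_mul_sum, sum_arrow_sum]
    simp only [hleft, hright]
  rw [covariance_eq_sub (hG.memLp_traceWord hp _) (hG.memLp_traceWord hq _)]
  simp only [Pi.mul_apply]
  rw [hprod, hG.integral_traceWord hp, hG.integral_traceWord hq, mul_mul_mul_comm, ← pow_add,
    hsplit, ← mul_sub, ← Finset.sum_sub_distrib]
  simp only [hmom, hmul]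
  rw [Finset.sum_congr rfl fun i _ => sum_pairPerms_sub pointKey_injective
    (fun x y => entryCov γ (letterEntry τ i x) (letterEntry τ i y)), Finset.sum_comm, Finset.mul_sum]
  refine Finset.sum_congr rfl fun π hπ => ?_
  rw [sum_prod_entryCov γ τ (mem_spokePerms.1 hπ).1, Finset.mul_sum]
  refine Finset.sum_congr rfl fun U _ => ?_
  ring

end Covariance

/-! ### The limit -/

section Limit

theorem tendsto_pow_mul_pow {n v : ℕ} (h : 2 * v ≤ n) :
    Tendsto (fun N : ℕ => (1 / √(N : ℝ)) ^ n * (N : ℝ) ^ v) atTop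
      (𝓝 (if 2 * v = n then 1 else 0)) := by
  have h1 : (fun N : ℕ => (1 / √(N : ℝ)) ^ (n - 2 * v)) =ᶠ[atTop]
      fun N : ℕ => (1 / √(N : ℝ)) ^ n * (N : ℝ) ^ v := by
    -- The identity can fail at `N = 0`, where `1 / √0 = 0`.
    filter_upwards [eventually_ge_atTop 1] with N hN
    have hN' : (0 : ℝ) < N := by exact_mod_cast hN
    have h2 : (N : ℝ) ^ v = √(N : ℝ) ^ (2 * v) := by
      rw [pow_mul, Real.sq_sqrt hN'.le]
    have h3 : √(N : ℝ) ≠ 0 := (Real.sqrt_pos.2 hN').ne'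
    obtain ⟨m, rfl⟩ := Nat.exists_eq_add_of_le h
    rw [h2, Nat.add_sub_cancel_left, pow_add, mul_right_comm, ← mul_pow, one_div_mul_cancel h3,
      one_pow, one_mul]
  refine Tendsto.congr' h1 ?_
  split_ifs with h2
  · simp [h2]
  · have h3 : Tendsto (fun N : ℕ => 1 / √(N : ℝ)) atTop (𝓝 0) := by
      simp only [one_div]
      exact tendsto_inv_atTop_zero.comp (Real.tendsto_sqrt_atTop.comp tendsto_natCast_atTop_atTop)
    have h4 := h3.pow (n - 2 * v)
    rwa [zero_pow (by omega)] at h4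

variable {p q : ℕ}

theorem sum_gluingWeight (γ : ℝ) (τ : Fin p ⊕ Fin q → Letter)
    {π : Equiv.Perm (Fin p ⊕ Fin q)} (hπ : π ∈ spokePerms p q) :
    ∑ U ∈ (firsts (pointKey p q) π).powerset, gluingWeight γ τ π U *
      (if 2 * numVertices (rot p q) π (twistOf π U) = p + q then 1 else 0) =
    (if π ∈ NC2 p q then γ ^ numSame π τ else 0) +
      if reflectPerm π ∈ NC2 p q then
        γ ^ (numSame (reflectPerm π) (reverseOuter τ) + numSpokes (reflectPerm π) -
          2 * numSameSpokes (reflectPerm π) (reverseOuter τ)) else 0 := by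
  obtain ⟨hP, hsp⟩ := mem_spokePerms.1 hπ
  set T := firsts (pointKey p q) π with hT
  set S := T.filter fun x => OnSpoke π x with hS
  -- Since a spoke exists, the two surviving choices of twists differ, and each can be counted
  -- separately.
  have hne : (∅ : Finset (Fin p ⊕ Fin q)) ≠ S := by
    intro h
    have h1 : ∀ x, ¬ OnSpoke π x := by
      rw [forall_iff_forall_firsts pointKey_injective hP
        (fun x => (not_congr (onSpoke_apply hP x)).1)]
      intro x hx hx'
      exact Finset.notMem_empty x (h ▸ Finset.mem_filter.2 ⟨hx, hx'⟩)
    exact h1 _ hsp.choose_spec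
  have hiff : ∀ U ∈ T.powerset, (2 * numVertices (rot p q) π (twistOf π U) = p + q ↔
      U = ∅ ∧ π ∈ NC2 p q ∨ U = S ∧ reflectPerm π ∈ NC2 p q) := by
    intro U hU
    have hU := Finset.mem_powerset.1 hU
    rw [two_mul_numVertices_eq_iff hP hsp (twistOf_apply hP U)]
    refine or_congr (and_congr_left fun _ => ?_) (and_congr_left fun _ => ?_)
    · refine ⟨fun h => Finset.eq_empty_of_forall_notMem fun x hx => h x (Or.inl hx), ?_⟩
      rintro rfl x
      simp [twistOf]
    · rw [forall_iff_forall_firsts pointKey_injective hP (fun x => by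
        rw [twistOf_apply hP, onSpoke_apply hP]; exact id)]
      constructor
      · intro h
        ext x
        rw [hS, Finset.mem_filter]
        refine ⟨fun hx => ⟨hU hx, (h x (hU hx)).1 (Or.inl hx)⟩, fun hx => ?_⟩
        exact (twistOf_iff_of_mem_firsts hP hU hx.1).1 ((h x hx.1).2 hx.2)
      · rintro rfl x hx
        rw [twistOf_iff_of_mem_firsts hP hU hx, Finset.mem_filter]
        exact and_iff_right hx
  have hsplit : ∀ U ∈ T.powerset, gluingWeight γ τ π U *
      (if 2 * numVertices (rot p q) π (twistOf π U) = p + q then 1 else 0) =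
      (if U = ∅ then (if π ∈ NC2 p q then gluingWeight γ τ π ∅ else 0) else 0) +
        if U = S then (if reflectPerm π ∈ NC2 p q then gluingWeight γ τ π S else 0) else 0 := by
    intro U hU
    simp only [hiff U hU]
    by_cases h1 : U = ∅
    · subst h1
      simp [hne]
    · by_cases h2 : U = S
      · subst h2
        simp [h1]
      · simp [h1, h2]
  rw [Finset.sum_congr rfl hsplit, Finset.sum_add_distrib, Finset.sum_ite_eq',
    Finset.sum_ite_eq', if_pos (Finset.empty_mem_powerset _),
    if_pos (Finset.mem_powerset.2 (Finset.filter_subset _ _)),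
    pow_numSame pointKey_injective hP, pow_reflectPerm pointKey_injective hP]
  congr 2
  · simp [gluingWeight]
  · rw [gluingWeight, ← hT, Finset.prod_ite (p := fun x => OnSpoke π x), hS, Finset.filter_not]

theorem NC2_subset_spokePerms : NC2 p q ⊆ spokePerms p q := by
  intro π hπ
  obtain ⟨hP, u, v, huv, -⟩ := mem_NC2.1 hπ
  exact mem_spokePerms.2 ⟨hP, .inl u, by simp [OnSpoke, huv]⟩

theorem reflectPerm_mem_spokePerms {π : Equiv.Perm (Fin p ⊕ Fin q)} (hπ : π ∈ spokePerms p q) :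
    reflectPerm π ∈ spokePerms p q := by
  obtain ⟨hP, x, hx⟩ := mem_spokePerms.1 hπ
  refine mem_spokePerms.2 ⟨hP.reflectPerm, reflect p q x, ?_⟩
  rwa [onSpoke_reflectPerm, reflect_reflect]

/-- Reflection is an involution on the partitions with a spoke, so it reindexes the second summand
to `NC2 p q`. -/
theorem sum_spokePerms (f g : Equiv.Perm (Fin p ⊕ Fin q) → ℝ) :
    ∑ π ∈ spokePerms p q, ((if π ∈ NC2 p q then f π else 0) +
      if reflectPerm π ∈ NC2 p q then g (reflectPerm π) else 0) =
    ∑ π ∈ NC2 p q, (f π + g π) := by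
  have h : ∑ π ∈ spokePerms p q, (if reflectPerm π ∈ NC2 p q then g (reflectPerm π) else 0) =
      ∑ π ∈ spokePerms p q, if π ∈ NC2 p q then g π else 0 :=
    Finset.sum_bij' (fun π _ => reflectPerm π) (fun π _ => reflectPerm π)
      (fun π hπ => reflectPerm_mem_spokePerms hπ) (fun π hπ => reflectPerm_mem_spokePerms hπ)
      (fun π _ => reflectPerm_reflectPerm π) (fun π _ => reflectPerm_reflectPerm π)
      (fun π _ => rfl)
  rw [Finset.sum_add_distrib, h, ← Finset.sum_filter, ← Finset.sum_filter, Finset.sum_add_distrib,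
    Finset.filter_mem_eq_inter, Finset.inter_eq_right.2 NC2_subset_spokePerms]

end Limit

end EllipticCov

theorem proposition3p2 {p q : ℕ} (hp : 1 ≤ p) (hq : 1 ≤ q)
    (τ : Fin p ⊕ Fin q → EllipticCov.Letter) (γ : ℝ) (hγ : γ ∈ Set.Icc (-1 : ℝ) 1)
    {Ω : ℕ → Type*} [∀ N, MeasurableSpace (Ω N)]
    (P : ∀ N, Measure (Ω N)) [∀ N, IsProbabilityMeasure (P N)]
    (G : ∀ N, Ω N → Matrix (Fin N) (Fin N) ℝ)
    (hG : ∀ N, EllipticCov.IsRealGaussianElliptic γ (G N) (P N))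
    (W₁ W₂ : ∀ N, Ω N → ℝ)
    (hW₁ : ∀ N ω, W₁ N ω =
      EllipticCov.traceWord (fun t => τ (Sum.inl t)) (EllipticCov.normalized (G N ω)))
    (hW₂ : ∀ N ω, W₂ N ω =
      EllipticCov.traceWord (fun t => τ (Sum.inr t)) (EllipticCov.normalized (G N ω))) :
    (∀ N, MemLp (W₁ N) 2 (P N) ∧ MemLp (W₂ N) 2 (P N)) ∧
    Tendsto (fun N => cov[W₁ N, W₂ N; P N]) atTop
      (𝓝 (∑ π ∈ EllipticCov.NC2 p q,
        (γ ^ EllipticCov.numSame π τ +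
          γ ^ (EllipticCov.numSame π (EllipticCov.reverseOuter τ) + EllipticCov.numSpokes π
            - 2 * EllipticCov.numSameSpokes π (EllipticCov.reverseOuter τ))))) := by
  have h₁ : ∀ N, W₁ N = fun ω => EllipticCov.traceWord (fun t => τ (Sum.inl t))
      (EllipticCov.normalized (G N ω)) := fun N => funext (hW₁ N)
  have h₂ : ∀ N, W₂ N = fun ω => EllipticCov.traceWord (fun t => τ (Sum.inr t))
      (EllipticCov.normalized (G N ω)) := fun N => funext (hW₂ N)
  simp only [h₁, h₂]
  refine ⟨fun N => ⟨(hG N).memLp_traceWord hp _, (hG N).memLp_traceWord hq _⟩, ?_⟩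
  simp only [fun N => (hG N).covariance_traceWord hp hq τ]
  rw [← EllipticCov.sum_spokePerms]
  refine tendsto_finsetSum _ fun π hπ => ?_
  rw [← EllipticCov.sum_gluingWeight γ τ hπ]
  obtain ⟨hP, hsp⟩ := EllipticCov.mem_spokePerms.1 hπ
  exact tendsto_finsetSum _ fun U _ => (EllipticCov.tendsto_pow_mul_pow
    (EllipticCov.two_mul_numVertices_le hP hsp (EllipticCov.twistOf_apply hP U))).const_mul _
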